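/- **Setting.** A function $L$ on $\mathbb R_+=[0,\infty)$ is *slowly varying* if $L(cx)/L(x)\to1$ as $x\to\infty$ for every $c>0$. Let $\mathcal V$ be the class of functions $\vartheta:\mathbb R_+\to\mathbb R$ of the form $\vartheta=F\,L$, where $x^{-\alpha}F(x)\to1$ as $x\to\infty$ for some real $\alpha\ge0$, and $L$ is slowly varying. The degree $\partial\vartheta$ of $\vartheta\in\mathcal V$ is the unique $\alpha\ge 0$ for which $\vartheta(x)/x^{\alpha}$ is slowly varying. For $\vartheta$ with $\vartheta(0)=0$, let $\iota[\vartheta]:\mathbb N\to\mathbb R$ be the additive function with $\iota[\vartheta](p^\ell)=\vartheta(\ell\log p)$ for all primes $p$ and integers $\ell\ge0$, that is, $\iota[\vartheta](k)=\sum_{p\mid k}\vartheta(\alpha_p(k)\log p)$ with $\alpha_p$ the $p$-adic valuation. Let $(\varepsilon_p)_{p\text{ prime}}$ be independent random variables with $\mathbb P[\varepsilon_p=m]=(1-1/p)\,p^{-m}$ for $m=0,1,2,\dots$, and let $\eta$ be a Poisson random measure on $\mathcal X=(0,1]^2$ with intensity $\mu(ds,dx)=x^{-1}\,ds\,dx$.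 **Proposition 2.** Let $\vartheta\in\mathcal V$ satisfy $\vartheta(0)=0$, be continuously differentiable on $(0,\infty)$ and have degree $\partial\vartheta>0$. Let $\varphi=\iota[\vartheta]$, let $u_1,u_2\in\mathbb R$, and put $$Z_n=\sum_{p\le n,\ p\text{ prime}}\Big(\frac{u_1\,\varphi(p)}{\vartheta(\log n)}+u_2\,\frac{\log p}{\log n}\Big)\varepsilon_p .$$ Then the integrals $\int_{\mathcal X}x^{\partial\vartheta}\,\eta(ds,dx)$ and $\int_{\mathcal X}x\,\eta(ds,dx)$ are almost surely finite, and, as $n\to\infty$, $$Z_n\ \xrightarrow{\ \mathrm{Law}\ }\ u_1\int_{\mathcal X}x^{\partial\vartheta}\,\eta(ds,dx)+u_2\int_{\mathcal X}x\,\eta(ds,dx).$$ -/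

import Mathlib

open MeasureTheory ProbabilityTheory Filter Topology
open scoped NNReal ENNReal

/-- `L` is slowly varying at infinity: `L (c x) / L x → 1` as `x → ∞`, for every `c > 0`.
Taking `c = 1` and recalling `0 / 0 = 0`, this forces `L` to be nonzero near infinity. -/
def SlowlyVarying (L : ℝ → ℝ) : Prop :=
  ∀ c : ℝ, 0 < c → Tendsto (fun x : ℝ => L (c * x) / L x) atTop (𝓝 1)

/-- The class `𝒱` of functions on `[0, ∞)` of the form `F * L`, with `x ^ (-α) * F x → 1` for some
real `α ≥ 0` and `L` slowly varying. (Values at negative arguments are irrelevant.) -/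
def ClassV (θ : ℝ → ℝ) : Prop :=
  ∃ (α : ℝ) (F L : ℝ → ℝ), 0 ≤ α ∧
    Tendsto (fun x : ℝ => x ^ (-α) * F x) atTop (𝓝 1) ∧
    SlowlyVarying L ∧ ∀ x : ℝ, 0 ≤ x → θ x = F x * L x

/-- `α ≥ 0` is a degree of `θ`: `θ x / x ^ α` is slowly varying. -/
def IsDegree (θ : ℝ → ℝ) (α : ℝ) : Prop :=
  0 ≤ α ∧ SlowlyVarying (fun x : ℝ => θ x / x ^ α)

theorem IsDegree.unique {θ : ℝ → ℝ} {α β : ℝ} (hα : IsDegree θ α) (hβ : IsDegree θ β) :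
    α = β := by
  have key : ∀ {γ : ℝ}, IsDegree θ γ →
      Tendsto (fun x : ℝ => θ (2 * x) / θ x) atTop (𝓝 ((2 : ℝ) ^ γ)) := by
    intro γ h
    have h1 := (h.2 2 two_pos).mul_const ((2 : ℝ) ^ γ)
    rw [one_mul] at h1
    refine h1.congr' ?_
    filter_upwards [eventually_gt_atTop (0 : ℝ)] with x hx
    have hx' : x ^ γ ≠ 0 := (Real.rpow_pos_of_pos hx γ).ne'
    have h2 : (2 : ℝ) ^ γ ≠ 0 := (Real.rpow_pos_of_pos two_pos γ).ne'
    rw [Real.mul_rpow two_pos.le hx.le]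
    by_cases h0 : θ x = 0
    · simp [h0]
    · field_simp
  have h := tendsto_nhds_unique (key hα) (key hβ)
  have h' := congrArg Real.log h
  rw [Real.log_rpow two_pos, Real.log_rpow two_pos] at h'
  exact mul_right_cancel₀ (Real.log_pos one_lt_two).ne' h'

theorem ClassV.exists_isDegree {θ : ℝ → ℝ} (h : ClassV θ) : ∃ α : ℝ, IsDegree θ α := by
  obtain ⟨α, F, L, hα, hF, hL, hθ⟩ := h
  refine ⟨α, hα, fun c hc => ?_⟩
  have hcx : Tendsto (fun x : ℝ => c * x) atTop atTop := tendsto_id.const_mul_atTop hc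
  have h1 := ((hF.comp hcx).div hF one_ne_zero).mul (hL c hc)
  rw [div_one, one_mul] at h1
  refine h1.congr' ?_
  filter_upwards [eventually_gt_atTop (0 : ℝ)] with x hx
  have hcx0 : 0 < c * x := mul_pos hc hx
  simp only [Function.comp_apply, Pi.div_apply, hθ x hx.le, hθ _ hcx0.le, Real.rpow_neg hx.le,
    Real.rpow_neg hcx0.le, div_eq_mul_inv, mul_inv]
  ring

open Classical in
/-- The degree `∂θ` of `θ`: the unique `α ≥ 0` such that `θ x / x ^ α` is slowly varying
(it exists for every `θ` in the class `𝒱`; the value is `0` if there is none). -/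
noncomputable def degree (θ : ℝ → ℝ) : ℝ :=
  if h : ∃ α : ℝ, IsDegree θ α then h.choose else 0

theorem ClassV.isDegree_degree {θ : ℝ → ℝ} (h : ClassV θ) : IsDegree θ (degree θ) := by
  have hex := h.exists_isDegree
  rw [degree, dif_pos hex]
  exact hex.choose_spec

/-- The additive arithmetic function `ι[θ]` with `ι[θ] (p ^ l) = θ (l * log p)`, extended to all
positive integers by `ι[θ] k = ∑ p, θ (α_p(k) * log p)`, the sum being over the primes
dividing `k`. -/
noncomputable def additiveEmbedding (θ : ℝ → ℝ) (k : ℕ) : ℝ :=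
  k.factorization.sum fun p l => θ ((l : ℝ) * Real.log p)

/-- A family `ε_p`, `p` prime, of independent geometric random variables with
`P[ε_p = m] = (1 - 1 / p) * p ^ (-m)` for `m = 0, 1, 2, …`. (Nothing is asked of `ε k` for
non-prime `k`, and these are never used.) -/
structure IsGeometricPrimeFamily {Ω : Type*} [MeasurableSpace Ω] (P : Measure Ω)
    (ε : ℕ → Ω → ℕ) : Prop where
  measurable : ∀ p : ℕ, p.Prime → Measurable (ε p)
  indep : iIndepFun (fun p : {p : ℕ // p.Prime} => ε p) P
  law : ∀ p : ℕ, p.Prime → ∀ m : ℕ,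
    P {ω | ε p ω = m} = ENNReal.ofReal ((1 - 1 / (p : ℝ)) * ((p : ℝ) ^ m)⁻¹)

/-- `η` is a Poisson random measure on `E` with intensity `μ`: a random measure such that `η B` is
Poisson distributed with mean `μ B` for every measurable `B` (and a.s. infinite if `μ B = ∞`), and
such that its values on pairwise disjoint measurable sets are independent. -/
structure IsPoissonRandomMeasure {Ω E : Type*} [MeasurableSpace Ω] [MeasurableSpace E]
    (P : Measure Ω) (η : Ω → Measure E) (μ : Measure E) : Prop where
  measurable : Measurable η
  law_of_ne_top : ∀ B : Set E, MeasurableSet B → μ B ≠ ∞ →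
    P.map (fun ω => η ω B) = (poissonMeasure (μ B).toNNReal).map (fun k : ℕ => (k : ℝ≥0∞))
  eq_top : ∀ B : Set E, MeasurableSet B → μ B = ∞ → ∀ᵐ ω ∂P, η ω B = ∞
  indep : ∀ (k : ℕ) (B : Fin k → Set E), (∀ i, MeasurableSet (B i)) →
    Pairwise (fun i j => Disjoint (B i) (B j)) → iIndepFun (fun i ω => η ω (B i)) P

/-- The space `𝒳 = (0, 1]²` of points `(t, x)`. -/
abbrev DickmanSpace : Type := ↥(Set.Ioc (0 : ℝ) 1) × ↥(Set.Ioc (0 : ℝ) 1)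

/-- The measure `dt dx / x` on `(0, 1]²`, where `dt` and `dx` are Lebesgue measure on `(0, 1]`. -/
noncomputable def dickmanIntensity : Measure DickmanSpace :=
  (((volume : Measure ℝ).comap ((↑) : ↥(Set.Ioc (0 : ℝ) 1) → ℝ)).prod
    ((volume : Measure ℝ).comap ((↑) : ↥(Set.Ioc (0 : ℝ) 1) → ℝ))).withDensity
      fun z => ENNReal.ofReal (1 / (z.2 : ℝ))

/-- `Z_n = ∑_{p ≤ n} (u₁ φ(p) / θ(log n) + u₂ log p / log n) ε_p` with `φ = ι[θ]`; the sum is over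
the primes `p ≤ n`. -/
noncomputable def geometricSum {Ω : Type*} (θ : ℝ → ℝ) (u₁ u₂ : ℝ) (ε : ℕ → Ω → ℕ)
    (n : ℕ) (ω : Ω) : ℝ :=
  ∑ p ∈ Nat.primesLE n,
    (u₁ * additiveEmbedding θ p / θ (Real.log n) + u₂ * (Real.log p / Real.log n)) * (ε p ω : ℝ)

/-! By Lévy's continuity theorem it is enough to let characteristic functions converge. With `z =
exp(i c)`, the characteristic function of `c ε_p` at argument one is `(p - 1) / (p - z)`, which
differs from `exp ((z - 1) / p)` by `O(|z - 1| / p²)`: each `ε_p` is almost Poisson of mean `1 / p`.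
The characteristic function of the sum is therefore close to `exp (∑ (exp(i c_p) - 1) / p)`, and
three facts identify its limit.

Masses `1 / p` placed at the points `log p / log n` converge to `dx / x` on `(0, 1]`. This follows
from Mertens' first theorem by partial summation and Weierstrass approximation
(`tendsto_sum_primes_integral`). Regular variation makes `θ(log p) / θ(log n)` close to `(log p /
log n) ^ α`, uniformly in `p ≤ n` (`eventually_forall_abs_div_sub_rpow_le`). Campbell's formula
recognises the resulting exponential as the characteristic function of the Poisson integral
(`integral_cexp_integral`).

The obstacle is that `dx / x` has infinite mass at `0`, so uniform errors are useless. Errors in the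
weights are instead measured against `x ^ γ` with `γ > 0`, for which `∑ (log p / log n) ^ γ / p`
stays bounded. -/

/-! ### Mertens' first theorem -/

theorem log_factorial_eq_sum_primesLE (n : ℕ) :
    Real.log (n.factorial : ℝ)
      = ∑ p ∈ Nat.primesLE n, (padicValNat p n.factorial : ℝ) * Real.log p := by
  rw [Real.log_nat_eq_sum_factorization]
  rw [Finsupp.sum_of_support_subset (s := Nat.primesLE n)]
  · refine Finset.sum_congr rfl fun p hp => ?_
    rw [Nat.factorization_def _ (Nat.prime_of_mem_primesLE hp)]
  · intro p hp
    have hp' : p ∈ n.factorial.primeFactors := by simpa using hp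
    have h := Nat.prime_of_mem_primeFactors hp'
    exact Nat.mem_primesLE.2 ⟨(h.dvd_factorial).1 (Nat.dvd_of_mem_primeFactors hp'), h⟩
  · intros; simp

theorem div_le_padicValNat_factorial {p : ℕ} (hp : p.Prime) (n : ℕ) :
    n / p ≤ padicValNat p n.factorial := by
  have := Fact.mk hp
  rcases Nat.lt_or_ge n p with h | h
  · simp [Nat.div_eq_of_lt h]
  rw [padicValNat_factorial (Nat.lt_succ_self _)]
  have : n / p ^ 1 ≤ ∑ i ∈ Finset.Ico 1 (Nat.log p n).succ, n / p ^ i :=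
    Finset.single_le_sum (f := fun i => n / p ^ i) (fun _ _ => Nat.zero_le _)
      (by simpa using Nat.log_pos hp.one_lt h)
  simpa using this

theorem padicValNat_factorial_le_div {p : ℕ} (hp : p.Prime) (n : ℕ) :
    (padicValNat p n.factorial : ℝ) ≤ n / (p - 1 : ℝ) := by
  have := Fact.mk hp
  have h1 : (p - 1) * padicValNat p n.factorial ≤ n := by
    rw [sub_one_mul_padicValNat_factorial]; exact Nat.sub_le _ _
  have h2 : (1 : ℝ) < p := by exact_mod_cast hp.one_lt
  rw [le_div_iff₀ (by linarith), mul_comm]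
  have := (Nat.cast_le (α := ℝ)).2 h1
  rwa [Nat.cast_mul, Nat.cast_sub hp.one_lt.le, Nat.cast_one] at this

/-- The quantity `log p / (p (p - 1))` is the excess of `log p / (p - 1)` over `log p / p`, that is,
the share of higher prime powers in `log n!`. This bound makes it summable. -/
theorem log_div_le_rpow {p : ℕ} (hp : p.Prime) :
    Real.log p / (p * (p - 1 : ℝ)) ≤ 4 * (p : ℝ) ^ (-(3 / 2) : ℝ) := by
  have h2 : (2 : ℝ) ≤ p := by exact_mod_cast hp.two_le
  have hl : Real.log p ≤ (p : ℝ) ^ (1 / 2 : ℝ) / (1 / 2) :=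
    Real.log_le_rpow_div (by linarith) (by norm_num)
  rw [div_le_iff₀ (by nlinarith)]
  have h3 : (p : ℝ) ^ (1 / 2 : ℝ) = (p : ℝ) ^ (-(3 / 2) : ℝ) * (p * p) := by
    rw [← pow_two, ← Real.rpow_natCast, ← Real.rpow_add (by linarith)]; norm_num
  have h4 : 0 < (p : ℝ) ^ (-(3 / 2) : ℝ) := Real.rpow_pos_of_pos (by linarith) _
  rw [h3] at hl
  nlinarith [mul_nonneg h4.le (mul_nonneg (by linarith : (0 : ℝ) ≤ p) (sub_nonneg.2 h2))]

/-- **Mertens' first theorem** -/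
theorem exists_abs_sum_log_div_sub_log_le :
    ∃ C : ℝ, ∀ n : ℕ, 1 ≤ n →
      |∑ p ∈ Nat.primesLE n, Real.log p / p - Real.log n| ≤ C := by
  have hsum : Summable fun k : ℕ => 4 * (k : ℝ) ^ (-(3 / 2) : ℝ) :=
    (Real.summable_nat_rpow.2 (by norm_num)).mul_left 4
  refine ⟨max (Real.log 4) (1 + ∑' k : ℕ, 4 * (k : ℝ) ^ (-(3 / 2) : ℝ)), fun n hn => ?_⟩
  have hn0 : (0 : ℝ) < n := by exact_mod_cast hn
  have hlp : ∀ p ∈ Nat.primesLE n, 0 ≤ Real.log p := fun p hp =>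
    Real.log_nonneg (by exact_mod_cast (Nat.one_lt_of_mem_primesLE hp).le)
  rw [abs_le']
  constructor
  · refine le_trans ?_ (le_max_left _ _)
    have h1 : Real.log (n.factorial : ℝ) ≤ n * Real.log n := by
      rw [← Real.log_pow]
      exact Real.log_le_log (by exact_mod_cast n.factorial_pos)
        (by exact_mod_cast Nat.factorial_le_pow n)
    have h2 : ∑ p ∈ Nat.primesLE n, ((n : ℝ) / p - 1) * Real.log p
        ≤ Real.log (n.factorial : ℝ) := by
      rw [log_factorial_eq_sum_primesLE]
      refine Finset.sum_le_sum fun p hp => mul_le_mul_of_nonneg_right ?_ (hlp p hp)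
      refine le_trans ?_ (Nat.cast_le.2
        (div_le_padicValNat_factorial (Nat.prime_of_mem_primesLE hp) n))
      have := Nat.lt_floor_add_one ((n : ℝ) / p)
      rw [Nat.floor_div_eq_div] at this
      linarith
    -- Rounding `n / p` down loses at most `∑ log p`, which Chebyshev bounds by `n log 4`.
    have h3 := Chebyshev.theta_le_log4_mul_x hn0.le
    rw [Chebyshev.theta_eq_sum_primesLE_log] at h3
    have h4 : ∑ p ∈ Nat.primesLE n, ((n : ℝ) / p - 1) * Real.log p
        = n * (∑ p ∈ Nat.primesLE n, Real.log p / p) - ∑ p ∈ Nat.primesLE n, Real.log p := by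
      rw [Finset.mul_sum, ← Finset.sum_sub_distrib]
      exact Finset.sum_congr rfl fun p _ => by ring
    nlinarith
  · refine le_trans ?_ (le_max_right _ _)
    -- The `1` in the constant is the `-n` of `n log n - n` in Stirling's lower bound.
    have h1 := Stirling.le_log_factorial_stirling (Nat.one_le_iff_ne_zero.1 hn)
    have h1' : (0 : ℝ) ≤ Real.log n := Real.log_nonneg (by exact_mod_cast hn)
    have h1'' : 0 ≤ Real.log (2 * Real.pi) :=
      Real.log_nonneg (by nlinarith [Real.pi_gt_three])
    have h2 : Real.log (n.factorial : ℝ) ≤ n * (∑ p ∈ Nat.primesLE n, Real.log p / p)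
        + n * ∑ p ∈ Nat.primesLE n, Real.log p / (p * (p - 1 : ℝ)) := by
      rw [log_factorial_eq_sum_primesLE, Finset.mul_sum, Finset.mul_sum, ← Finset.sum_add_distrib]
      refine Finset.sum_le_sum fun p hp => ?_
      have hp' := Nat.prime_of_mem_primesLE hp
      have h2 : (2 : ℝ) ≤ p := by exact_mod_cast hp'.two_le
      refine (mul_le_mul_of_nonneg_right (padicValNat_factorial_le_div hp' n) (hlp p hp)).trans ?_
      have h3 : (p : ℝ) - 1 ≠ 0 := by linarith
      apply le_of_eq
      field_simp
      ring
    have h3 : ∑ p ∈ Nat.primesLE n, Real.log p / (p * (p - 1 : ℝ))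
        ≤ ∑' k : ℕ, 4 * (k : ℝ) ^ (-(3 / 2) : ℝ) :=
      (Finset.sum_le_sum fun p hp => log_div_le_rpow (Nat.prime_of_mem_primesLE hp)).trans
        (hsum.sum_le_tsum _ fun k _ => by positivity)
    nlinarith

/-! ### Logarithmic moments of the primes -/

theorem hasDerivAt_log_rpow (b : ℝ) {t : ℝ} (ht : 1 < t) :
    HasDerivAt (fun t => Real.log t ^ b) (b * Real.log t ^ (b - 1) / t) t := by
  have := (Real.hasDerivAt_log (by linarith : t ≠ 0)).rpow_const (p := b)
    (Or.inl (Real.log_pos ht).ne')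
  convert this using 1
  ring

theorem continuousOn_log_rpow_div (b d : ℝ) (n : ℝ) :
    ContinuousOn (fun t => d * Real.log t ^ b / t) (Set.Icc 2 n) := by
  intro t ht
  have h2 : (2 : ℝ) ≤ t := ht.1
  have h1 : Real.log t ≠ 0 := (Real.log_pos (by linarith)).ne'
  refine ContinuousAt.continuousWithinAt ?_
  have hl : ContinuousAt Real.log t := Real.continuousAt_log (by linarith)
  exact ((hl.rpow_const (Or.inl h1)).const_mul d).div continuousAt_id (by simp; linarith)

theorem integral_log_rpow (b : ℝ) {n : ℝ} (hn : 2 ≤ n) :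
    ∫ t in (2 : ℝ)..n, b * Real.log t ^ (b - 1) / t = Real.log n ^ b - Real.log 2 ^ b := by
  refine intervalIntegral.integral_eq_sub_of_hasDerivAt (f := fun t => Real.log t ^ b) ?_ ?_
  · intro t ht
    rw [Set.uIcc_of_le hn] at ht
    exact hasDerivAt_log_rpow b (by linarith [ht.1])
  · refine ContinuousOn.intervalIntegrable ?_
    rw [Set.uIcc_of_le hn]
    exact continuousOn_log_rpow_div _ _ _

/-- Partial summation of `log p / p` against the weight `log ^ (β - 1)`, with Mertens' `log t +
O(1)` as summatory function. The main terms combine as `1 - (β - 1) / β = 1 / β`. Either error term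
may dominate, according to the sign of `β - 1`. -/
theorem exists_abs_sum_log_rpow_div_sub_le {β : ℝ} (hβ : 0 < β) :
    ∃ C D : ℝ, ∀ n : ℕ, 2 ≤ n →
      |∑ p ∈ Nat.primesLE n, Real.log p ^ β / p - Real.log n ^ β / β|
        ≤ C * Real.log n ^ (β - 1) + D := by
  obtain ⟨C, hC⟩ := exists_abs_sum_log_div_sub_log_le
  set c : ℕ → ℝ := fun k => if k.Prime then Real.log k / k else 0 with hc
  have hA : ∀ n : ℕ, ∑ k ∈ Finset.Icc 0 n, c k = ∑ p ∈ Nat.primesLE n, Real.log p / p := by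
    intro n
    rw [Nat.primesLE_eq_filter_Icc_zero, Finset.sum_filter]
  -- Passing from integers to real `t` costs `log 2`, since `t ≤ 2 ⌊t⌋`.
  have hR : ∀ t : ℝ, 2 ≤ t →
      |∑ k ∈ Finset.Icc 0 ⌊t⌋₊, c k - Real.log t| ≤ C + Real.log 2 := by
    intro t ht
    have hf : 2 ≤ ⌊t⌋₊ := Nat.le_floor (by exact_mod_cast ht)
    have hf' : (2 : ℝ) ≤ ⌊t⌋₊ := by exact_mod_cast hf
    have h1 := hC ⌊t⌋₊ (by omega)
    rw [← hA] at h1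
    have h2 : Real.log ⌊t⌋₊ ≤ Real.log t :=
      Real.log_le_log (by linarith) (Nat.floor_le (by linarith))
    have h3 : Real.log t ≤ Real.log 2 + Real.log ⌊t⌋₊ := by
      rw [← Real.log_mul (by norm_num) (by linarith)]
      exact Real.log_le_log (by linarith) (by linarith [Nat.lt_floor_add_one t])
    rw [abs_le] at h1 ⊢
    have := Real.log_pos one_lt_two
    constructor <;> linarith [h1.1, h1.2]
  have hC0 : 0 ≤ C := (abs_nonneg _).trans (hC 1 le_rfl)
  have hl2 := Real.log_pos one_lt_two
  set C' := C + Real.log 2 with hC'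
  refine ⟨2 * C', C' * Real.log 2 ^ (β - 1) + |(β - 1) / β * Real.log 2 ^ β|, fun n hn => ?_⟩
  have hn' : (2 : ℝ) ≤ n := by exact_mod_cast hn
  have hln : 0 < Real.log n := Real.log_pos (by linarith)
  set g : ℝ → ℝ := fun t => (β - 1) * Real.log t ^ (β - 1 - 1) / t with hg
  have hder : ∀ t ∈ Set.Icc (2 : ℝ) n, HasDerivAt (fun t => Real.log t ^ (β - 1)) (g t) t :=
    fun t ht => hasDerivAt_log_rpow _ (by linarith [ht.1])
  have hgc : ContinuousOn g (Set.Icc 2 n) := continuousOn_log_rpow_div _ _ _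
  have hgi : IntegrableOn g (Set.Icc 2 n) := hgc.integrableOn_Icc
  have habel := sum_mul_eq_sub_integral_mul₁ (f := fun t => Real.log t ^ (β - 1)) c
    (by simp [hc]) (by simp [hc]) (n : ℝ)
    (fun t ht => (hder t ht).differentiableAt)
    (hgi.congr_fun (fun t ht => (hder t ht).deriv.symm) measurableSet_Icc)
  rw [Nat.floor_natCast] at habel
  have hlhs : ∑ k ∈ Finset.Icc 0 n, Real.log k ^ (β - 1) * c k
      = ∑ p ∈ Nat.primesLE n, Real.log p ^ β / p := by
    rw [Nat.primesLE_eq_filter_Icc_zero, Finset.sum_filter]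
    refine Finset.sum_congr rfl fun k _ => ?_
    simp only [hc]
    split_ifs with hk
    · have : 0 < Real.log k := Real.log_pos (by exact_mod_cast hk.one_lt)
      rw [Real.rpow_sub_one this.ne']
      field_simp
    · simp
  have hAi : IntegrableOn (fun t => g t * ∑ k ∈ Finset.Icc 0 ⌊t⌋₊, c k) (Set.Ioc 2 (n : ℝ)) :=
    (integrableOn_mul_sum_Icc c (by norm_num) hgi).mono_set Set.Ioc_subset_Icc_self
  have hli : IntegrableOn (fun t => g t * Real.log t) (Set.Ioc 2 (n : ℝ)) := by
    refine ContinuousOn.integrableOn_Icc ?_ |>.mono_set Set.Ioc_subset_Icc_self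
    exact hgc.mul (fun t ht =>
      (Real.continuousAt_log (by linarith [ht.1])).continuousWithinAt)
  have hint : ∫ t in Set.Ioc (2 : ℝ) n, deriv (fun t => Real.log t ^ (β - 1)) t *
        ∑ k ∈ Finset.Icc 0 ⌊t⌋₊, c k
      = (∫ t in Set.Ioc (2 : ℝ) n, g t * (∑ k ∈ Finset.Icc 0 ⌊t⌋₊, c k - Real.log t))
        + (β - 1) / β * (Real.log n ^ β - Real.log 2 ^ β) := by
    rw [← integral_log_rpow β hn', ← intervalIntegral.integral_const_mul,
      intervalIntegral.integral_of_le hn', ← integral_add]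
    · refine setIntegral_congr_fun measurableSet_Ioc fun t ht => ?_
      have h2 : 0 < Real.log t := Real.log_pos (by linarith [ht.1])
      have ht0 : 0 < t := by linarith [ht.1]
      simp only [(hder t (Set.Ioc_subset_Icc_self ht)).deriv, hg]
      rw [Real.rpow_sub_one h2.ne' (β - 1)]
      field_simp
      ring
    · exact (hAi.sub hli).congr (ae_of_all _ fun t => by simp [mul_sub])
    · exact ((continuousOn_log_rpow_div _ _ _).integrableOn_Icc.mono_set
        Set.Ioc_subset_Icc_self).const_mul _
  -- The derivative `g` has the constant sign of `β - 1`, so the integral of `|g|` is an explicit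
  -- difference of endpoint values.
  obtain ⟨σ, hσ, hσ'⟩ : ∃ σ : ℝ, |σ| = 1 ∧ ∀ t ∈ Set.Ioc (2 : ℝ) n, ‖g t‖ = σ * g t := by
    have hpos : ∀ t ∈ Set.Ioc (2 : ℝ) n, 0 ≤ Real.log t ^ (β - 1 - 1) / t := fun t ht =>
      div_nonneg (Real.rpow_nonneg (Real.log_nonneg (by linarith [ht.1])) _) (by linarith [ht.1])
    rcases le_total 1 β with h | h
    · refine ⟨1, by simp, fun t ht => ?_⟩
      rw [one_mul, Real.norm_of_nonneg]
      simp only [hg, mul_div_assoc]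
      exact mul_nonneg (by linarith) (hpos t ht)
    · refine ⟨-1, by simp, fun t ht => ?_⟩
      rw [neg_one_mul, Real.norm_of_nonpos]
      simp only [hg, mul_div_assoc]
      exact mul_nonpos_of_nonpos_of_nonneg (by linarith) (hpos t ht)
  have hbound : |∫ t in Set.Ioc (2 : ℝ) n, g t * (∑ k ∈ Finset.Icc 0 ⌊t⌋₊, c k - Real.log t)|
      ≤ C' * (Real.log n ^ (β - 1) + Real.log 2 ^ (β - 1)) := by
    have h1 : ‖∫ t in Set.Ioc (2 : ℝ) n, g t * (∑ k ∈ Finset.Icc 0 ⌊t⌋₊, c k - Real.log t)‖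
        ≤ ∫ t in Set.Ioc (2 : ℝ) n, C' * (σ * g t) := by
      refine norm_integral_le_of_norm_le
        (((hgi.mono_set Set.Ioc_subset_Icc_self).const_mul _).const_mul _) ?_
      refine (ae_restrict_iff' measurableSet_Ioc).2 (ae_of_all _ fun t ht => ?_)
      rw [norm_mul, hσ' t ht, mul_comm]
      exact mul_le_mul_of_nonneg_right (hR t ht.1.le) (hσ' t ht ▸ norm_nonneg _)
    have hgint : ∫ t in Set.Ioc (2 : ℝ) n, g t = Real.log n ^ (β - 1) - Real.log 2 ^ (β - 1) := by
      rw [← intervalIntegral.integral_of_le hn', integral_log_rpow (β - 1) hn']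
    rw [integral_const_mul, integral_const_mul, hgint] at h1
    refine h1.trans (mul_le_mul_of_nonneg_left ?_ (by positivity))
    refine (le_abs_self _).trans ?_
    rw [abs_mul, hσ, one_mul]
    refine (abs_sub _ _).trans ?_
    rw [abs_of_nonneg (by positivity), abs_of_nonneg (by positivity)]
  have hfin : |Real.log n ^ (β - 1) * (∑ k ∈ Finset.Icc 0 n, c k - Real.log n)|
      ≤ C' * Real.log n ^ (β - 1) := by
    rw [abs_mul, abs_of_nonneg (by positivity), mul_comm]
    refine mul_le_mul_of_nonneg_right ?_ (by positivity)
    simpa using hR n hn'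
  rw [hlhs, hint] at habel
  have hkey : ∑ p ∈ Nat.primesLE n, Real.log p ^ β / p - Real.log n ^ β / β
      = Real.log n ^ (β - 1) * (∑ k ∈ Finset.Icc 0 n, c k - Real.log n)
        - (∫ t in Set.Ioc (2 : ℝ) n, g t * (∑ k ∈ Finset.Icc 0 ⌊t⌋₊, c k - Real.log t))
        + (β - 1) / β * Real.log 2 ^ β := by
    rw [habel]
    have : Real.log n ^ β = Real.log n ^ (β - 1) * Real.log n := by
      rw [Real.rpow_sub_one hln.ne']; field_simp
    rw [this]
    field_simp
    ring
  rw [hkey]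
  refine (abs_add_le _ _).trans ?_
  refine (add_le_add_left (abs_sub _ _) _).trans ?_
  linarith

theorem tendsto_log_natCast_atTop : Tendsto (fun n : ℕ => Real.log n) atTop atTop :=
  Real.tendsto_log_atTop.comp tendsto_natCast_atTop_atTop

/-- The limit `1 / β` is the integral of `x ^ β` against `dx / x`; these moments determine the
limiting measure. -/
theorem tendsto_sum_log_div_log_rpow {β : ℝ} (hβ : 0 < β) :
    Tendsto (fun n : ℕ => ∑ p ∈ Nat.primesLE n, (Real.log p / Real.log n) ^ β / p) atTop
      (𝓝 (1 / β)) := by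
  obtain ⟨C, D, h⟩ := exists_abs_sum_log_rpow_div_sub_le hβ
  rw [tendsto_iff_norm_sub_tendsto_zero]
  have hlim : Tendsto (fun n : ℕ => C * (Real.log n)⁻¹ + D * Real.log n ^ (-β)) atTop (𝓝 0) := by
    have h1 := (tendsto_inv_atTop_zero.comp tendsto_log_natCast_atTop).const_mul C
    have h2 := ((tendsto_rpow_neg_atTop hβ).comp tendsto_log_natCast_atTop).const_mul D
    simpa using h1.add h2
  refine squeeze_zero' (Eventually.of_forall fun _ => norm_nonneg _) ?_ hlim
  filter_upwards [eventually_ge_atTop 2] with n hn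
  have hn' : (2 : ℝ) ≤ n := by exact_mod_cast hn
  have hln : 0 < Real.log n := Real.log_pos (by linarith)
  have hpos : 0 < Real.log n ^ β := Real.rpow_pos_of_pos hln _
  have h1 : ∑ p ∈ Nat.primesLE n, (Real.log p / Real.log n) ^ β / p - 1 / β
      = (∑ p ∈ Nat.primesLE n, Real.log p ^ β / p - Real.log n ^ β / β) / Real.log n ^ β := by
    rw [sub_div, Finset.sum_div]
    congr 1
    · refine Finset.sum_congr rfl fun p _ => ?_
      rw [Real.div_rpow (Real.log_natCast_nonneg p) hln.le]
      ring
    · field_simp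
  rw [h1, norm_div, Real.norm_of_nonneg hpos.le, div_le_iff₀ hpos, Real.norm_eq_abs]
  refine (h n hn).trans (le_of_eq ?_)
  rw [Real.rpow_sub_one hln.ne', Real.rpow_neg hln.le]
  field_simp

theorem log_div_log_mem_Ioc {n p : ℕ} (hp : p ∈ Nat.primesLE n) :
    Real.log p / Real.log n ∈ Set.Ioc (0 : ℝ) 1 := by
  have h1 : (1 : ℝ) < p := by exact_mod_cast Nat.one_lt_of_mem_primesLE hp
  have h2 : (p : ℝ) ≤ n := by exact_mod_cast Nat.le_of_mem_primesLE hp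
  have h3 := Real.log_pos h1
  have h4 := Real.log_le_log (by linarith) h2
  exact ⟨div_pos h3 (by linarith), (div_le_one (by linarith)).2 h4⟩

/-! ### From moments to continuous test functions. -/

theorem integrableOn_rpow_sub_one {γ : ℝ} (hγ : 0 < γ) :
    IntegrableOn (fun x : ℝ => x ^ (γ - 1)) (Set.Ioc 0 1) := by
  rw [← intervalIntegrable_iff_integrableOn_Ioc_of_le zero_le_one]
  exact intervalIntegral.intervalIntegrable_rpow' (by linarith)

theorem integral_rpow_sub_one {γ : ℝ} (hγ : 0 < γ) :
    ∫ x in Set.Ioc (0 : ℝ) 1, x ^ (γ - 1) = 1 / γ := by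
  rw [← intervalIntegral.integral_of_le zero_le_one, integral_rpow (Or.inl (by linarith))]
  simp [hγ.ne']

theorem integrableOn_rpow_sub_one_smul {E : Type*} [NormedAddCommGroup E] [NormedSpace ℝ E]
    {γ : ℝ} (hγ : 0 < γ) {q : ℝ → E} (hq : ContinuousOn q (Set.Icc 0 1)) :
    IntegrableOn (fun x : ℝ => x ^ (γ - 1) • q x) (Set.Ioc 0 1) := by
  obtain ⟨M, hM⟩ := isCompact_Icc.exists_bound_of_continuousOn hq
  refine Integrable.smul_bdd (integrableOn_rpow_sub_one hγ) M ?_ ?_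
  · exact (hq.mono Set.Ioc_subset_Icc_self).aestronglyMeasurable measurableSet_Ioc
  · exact (ae_restrict_iff' measurableSet_Ioc).2
      (ae_of_all _ fun x hx => hM x (Set.Ioc_subset_Icc_self hx))

theorem tendsto_sum_primes_polynomial {γ : ℝ} (hγ : 0 < γ) (P : Polynomial ℝ) :
    Tendsto (fun n : ℕ => ∑ p ∈ Nat.primesLE n,
        (Real.log p / Real.log n) ^ γ / p * P.eval (Real.log p / Real.log n)) atTop
      (𝓝 (∫ x in Set.Ioc (0 : ℝ) 1, x ^ (γ - 1) * P.eval x)) := by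
  have hi : ∀ i : ℕ, 0 < γ + i := fun i => by positivity
  have hint : ∫ x in Set.Ioc (0 : ℝ) 1, x ^ (γ - 1) * P.eval x
      = ∑ i ∈ Finset.range (P.natDegree + 1), P.coeff i * (1 / (γ + i)) := by
    rw [setIntegral_congr_fun (g := fun x => ∑ i ∈ Finset.range (P.natDegree + 1),
      P.coeff i * x ^ (γ + i - 1)) measurableSet_Ioc]
    · rw [integral_finsetSum _ fun i _ => (integrableOn_rpow_sub_one (hi i)).const_mul _]
      refine Finset.sum_congr rfl fun i _ => ?_
      rw [integral_const_mul, integral_rpow_sub_one (hi i)]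
    · intro x hx
      simp only [Polynomial.eval_eq_sum_range, Finset.mul_sum]
      refine Finset.sum_congr rfl fun i _ => ?_
      rw [add_sub_right_comm, Real.rpow_add_natCast hx.1.ne']
      ring
  rw [hint]
  have hlim := tendsto_finsetSum (Finset.range (P.natDegree + 1)) fun i _ =>
    (tendsto_sum_log_div_log_rpow (hi i)).const_mul (P.coeff i)
  refine hlim.congr fun n => ?_
  simp only [Finset.mul_sum, Polynomial.eval_eq_sum_range]
  rw [Finset.sum_comm]
  refine Finset.sum_congr rfl fun p hp => Finset.sum_congr rfl fun i _ => ?_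
  rw [Real.rpow_add_natCast (log_div_log_mem_Ioc hp).1.ne']
  ring

/-- The factor `x ^ γ` turns `dx / x` into a finite measure, so uniform approximation by polynomials
suffices. -/
theorem tendsto_sum_primes_of_continuousOn {γ : ℝ} (hγ : 0 < γ) {q : ℝ → ℝ}
    (hq : ContinuousOn q (Set.Icc 0 1)) :
    Tendsto (fun n : ℕ => ∑ p ∈ Nat.primesLE n,
        (Real.log p / Real.log n) ^ γ / p * q (Real.log p / Real.log n)) atTop
      (𝓝 (∫ x in Set.Ioc (0 : ℝ) 1, x ^ (γ - 1) * q x)) := by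
  rw [Metric.tendsto_atTop']
  intro ε hε
  -- `K` bounds both the limiting mass `1 / γ` and, eventually, the masses of the prime sums.
  set K := 1 / γ + 1 with hK
  have hK0 : 0 < K := by positivity
  obtain ⟨P, hP⟩ := exists_polynomial_near_of_continuousOn 0 1 q hq (ε / (3 * K)) (by positivity)
  have h1 := (tendsto_sum_log_div_log_rpow hγ).eventually (gt_mem_nhds (lt_add_one (1 / γ)))
  have h2 := (tendsto_sum_primes_polynomial hγ P).eventually
    (Metric.ball_mem_nhds _ (by positivity : 0 < ε / 3))
  have hI : |(∫ x in Set.Ioc (0 : ℝ) 1, x ^ (γ - 1) * P.eval x)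
      - ∫ x in Set.Ioc (0 : ℝ) 1, x ^ (γ - 1) * q x| ≤ ε / 3 := by
    have hPi : IntegrableOn (fun x : ℝ => x ^ (γ - 1) * P.eval x) (Set.Ioc 0 1) :=
      integrableOn_rpow_sub_one_smul hγ P.continuous.continuousOn
    have hqi : IntegrableOn (fun x : ℝ => x ^ (γ - 1) * q x) (Set.Ioc 0 1) :=
      integrableOn_rpow_sub_one_smul hγ hq
    rw [← integral_sub hPi hqi, ← Real.norm_eq_abs]
    refine (norm_integral_le_of_norm_le
      ((integrableOn_rpow_sub_one hγ).mul_const (ε / (3 * K))) ?_).trans ?_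
    · refine (ae_restrict_iff' measurableSet_Ioc).2 (ae_of_all _ fun x hx => ?_)
      rw [← mul_sub, norm_mul, Real.norm_of_nonneg (Real.rpow_nonneg hx.1.le _)]
      exact mul_le_mul_of_nonneg_left (hP x (Set.Ioc_subset_Icc_self hx)).le
        (Real.rpow_nonneg hx.1.le _)
    · rw [integral_mul_const, integral_rpow_sub_one hγ]
      calc 1 / γ * (ε / (3 * K)) ≤ K * (ε / (3 * K)) := by
            gcongr; linarith
        _ = ε / 3 := by field_simp
  have hev := h1.and h2
  rw [eventually_atTop] at hev
  obtain ⟨N, hN⟩ := hev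
  refine ⟨N, fun n hn => ?_⟩
  obtain ⟨h1, h2⟩ := hN n hn.le
  have hS : |∑ p ∈ Nat.primesLE n,
        (Real.log p / Real.log n) ^ γ / p * q (Real.log p / Real.log n)
      - ∑ p ∈ Nat.primesLE n,
        (Real.log p / Real.log n) ^ γ / p * P.eval (Real.log p / Real.log n)| ≤ ε / 3 := by
    rw [← Finset.sum_sub_distrib]
    refine (Finset.abs_sum_le_sum_abs _ _).trans ?_
    calc _ ≤ ∑ p ∈ Nat.primesLE n, (Real.log p / Real.log n) ^ γ / p * (ε / (3 * K)) := by
          refine Finset.sum_le_sum fun p hp => ?_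
          have hx := log_div_log_mem_Ioc hp
          have hnn : 0 ≤ (Real.log p / Real.log n) ^ γ / p :=
            div_nonneg (Real.rpow_nonneg hx.1.le _) (Nat.cast_nonneg _)
          rw [← mul_sub, abs_mul, abs_of_nonneg hnn, abs_sub_comm]
          exact mul_le_mul_of_nonneg_left (hP _ (Set.Ioc_subset_Icc_self hx)).le hnn
      _ ≤ K * (ε / (3 * K)) := by
          rw [← Finset.sum_mul]
          exact mul_le_mul_of_nonneg_right h1.le (by positivity)
      _ = ε / 3 := by field_simp
  rw [Real.dist_eq] at h2
  rw [Real.dist_eq]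
  rw [abs_le] at hS hI
  rw [abs_lt] at h2 ⊢
  constructor <;> linarith [hS.1, hS.2, hI.1, hI.2, h2.1, h2.2]

theorem tendsto_sum_primes_of_continuousOn_complex {γ : ℝ} (hγ : 0 < γ) {q : ℝ → ℂ}
    (hq : ContinuousOn q (Set.Icc 0 1)) :
    Tendsto (fun n : ℕ => ∑ p ∈ Nat.primesLE n,
        ((Real.log p / Real.log n) ^ γ / p) • q (Real.log p / Real.log n)) atTop
      (𝓝 (∫ x in Set.Ioc (0 : ℝ) 1, x ^ (γ - 1) • q x)) := by
  have hre := tendsto_sum_primes_of_continuousOn hγ (Complex.continuous_re.comp_continuousOn hq)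
  have him := tendsto_sum_primes_of_continuousOn hγ (Complex.continuous_im.comp_continuousOn hq)
  have h := ((Complex.continuous_ofReal.tendsto _).comp hre).add
    (((Complex.continuous_ofReal.tendsto _).comp him).mul_const Complex.I)
  have hint := integral_re_add_im (𝕜 := ℂ) (integrableOn_rpow_sub_one_smul hγ hq)
  simp only [Complex.real_smul, RCLike.re_to_complex, RCLike.im_to_complex, Complex.re_ofReal_mul,
    Complex.im_ofReal_mul, RCLike.I_to_complex] at hint
  simp only [Complex.real_smul]
  rw [← hint]
  refine h.congr fun n => ?_
  apply Complex.ext <;> simp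

/-- Sums over primes, on the logarithmic scale, converge to integrals with respect to `dx / x`. -/
theorem tendsto_sum_primes_integral {β C : ℝ} (hβ : 0 < β) {g : ℝ → ℂ}
    (hg : ContinuousOn g (Set.Ioc 0 1)) (hgb : ∀ x ∈ Set.Ioc (0 : ℝ) 1, ‖g x‖ ≤ C * x ^ β) :
    Tendsto (fun n : ℕ => ∑ p ∈ Nat.primesLE n, (1 / p : ℝ) • g (Real.log p / Real.log n)) atTop
      (𝓝 (∫ x in Set.Ioc (0 : ℝ) 1, (1 / x) • g x)) := by
  -- Half of the decay `x ^ β` makes the reference measure finite; the other half makes `q`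
  -- continuous at `0` with value `0`.
  set γ := β / 2 with hγ
  have hγ0 : 0 < γ := by positivity
  set q : ℝ → ℂ := fun x => x ^ (-γ) • (if x = 0 then 0 else g x) with hq
  have hqb : ∀ x ∈ Set.Icc (0 : ℝ) 1, ‖q x‖ ≤ C * x ^ γ := by
    intro x hx
    rcases hx.1.eq_or_lt with rfl | hx0
    · simp [hq, Real.zero_rpow hγ0.ne']
    · simp only [hq, hx0.ne', if_false, norm_smul, Real.norm_of_nonneg (Real.rpow_nonneg hx.1 _)]
      calc x ^ (-γ) * ‖g x‖ ≤ x ^ (-γ) * (C * x ^ β) :=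
            mul_le_mul_of_nonneg_left (hgb x ⟨hx0, hx.2⟩) (Real.rpow_nonneg hx.1 _)
        _ = C * (x ^ (-γ) * x ^ β) := by ring
        _ = C * x ^ γ := by rw [← Real.rpow_add hx0]; congr 2; rw [hγ]; ring
  have hqc : ContinuousOn q (Set.Icc 0 1) := by
    intro x hx
    rcases hx.1.eq_or_lt with rfl | hx0
    · have h0 : q 0 = 0 := by simp [hq]
      rw [ContinuousWithinAt, h0]
      refine squeeze_zero_norm' (eventually_mem_nhdsWithin.mono hqb) ?_
      have : Tendsto (fun x : ℝ => C * x ^ γ) (𝓝 0) (𝓝 (C * 0 ^ γ)) :=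
        ((Real.continuous_rpow_const hγ0.le).tendsto 0).const_mul C
      rw [Real.zero_rpow hγ0.ne', mul_zero] at this
      exact this.mono_left nhdsWithin_le_nhds
    · have h1 : ContinuousWithinAt (fun x => x ^ (-γ) • g x) (Set.Ioc 0 1) x :=
        (Real.continuousAt_rpow_const x _ (Or.inl hx0.ne')).continuousWithinAt.smul
          (hg x ⟨hx0, hx.2⟩)
      have h2 : ContinuousWithinAt q (Set.Ioc 0 1) x :=
        h1.congr (fun y hy => by simp [hq, hy.1.ne']) (by simp [hq, hx0.ne'])
      refine h2.mono_of_mem_nhdsWithin ?_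
      filter_upwards [self_mem_nhdsWithin, mem_nhdsWithin_of_mem_nhds (Ioi_mem_nhds hx0)]
        with y hy hy' using ⟨hy', hy.2⟩
  have hmain := tendsto_sum_primes_of_continuousOn_complex hγ0 hqc
  have hint : ∫ x in Set.Ioc (0 : ℝ) 1, x ^ (γ - 1) • q x
      = ∫ x in Set.Ioc (0 : ℝ) 1, (1 / x) • g x := by
    refine setIntegral_congr_fun measurableSet_Ioc fun x hx => ?_
    simp only [hq, hx.1.ne', if_false, smul_smul]
    rw [← Real.rpow_add hx.1, show γ - 1 + -γ = -1 by ring, Real.rpow_neg_one, one_div]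
  rw [← hint]
  refine hmain.congr fun n => Finset.sum_congr rfl fun p hp => ?_
  have hx := log_div_log_mem_Ioc hp
  simp only [hq, hx.1.ne', if_false, smul_smul]
  rw [div_mul_eq_mul_div, ← Real.rpow_add hx.1, add_neg_cancel, Real.rpow_zero]

/-! ### Uniformity in slow variation -/

/-- Truncation at `1` supplies the domination needed to integrate pointwise limits, and remains
subadditive. -/
theorem min_one_abs_add_le (a b : ℝ) : min 1 |a + b| ≤ min 1 |a| + min 1 |b| := by
  have := abs_add_le a b
  have ha := abs_nonneg a
  have hb := abs_nonneg b
  rcases le_total 1 |a| with h1 | h1 <;> rcases le_total 1 |b| with h2 | h2 <;>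
    simp only [min_eq_left, min_eq_right, h1, h2] <;>
    first
      | exact (min_le_left _ _).trans (by linarith)
      | exact (min_le_right _ _).trans (by linarith)

/-- **Uniform convergence theorem** for slowly varying functions, in additive form. -/
theorem eventually_forall_abs_sub_lt {h : ℝ → ℝ} (hm : Measurable h)
    (hlim : ∀ u, Tendsto (fun x => h (x + u) - h x) atTop (𝓝 0)) {δ : ℝ} (hδ : 0 < δ) :
    ∀ᶠ x in atTop, ∀ u ∈ Set.Icc (0 : ℝ) 1, |h (x + u) - h x| < δ := by
  set m : ℝ → ℝ → ℝ := fun x v => min 1 |h (x + v) - h x| with hmdef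
  have hm0 : ∀ x v, 0 ≤ m x v := fun x v => le_min zero_le_one (abs_nonneg _)
  have hm1 : ∀ x v, ‖m x v‖ ≤ 1 := fun x v => by
    rw [Real.norm_of_nonneg (hm0 x v)]; exact min_le_left _ _
  have hmm : ∀ x, Measurable (m x) := fun x => by
    have : Measurable fun v => h (x + v) - h x := (hm.comp (measurable_const_add x)).sub_const _
    exact measurable_const.min this.abs
  have hmi : ∀ x a b, IntervalIntegrable (m x) volume a b := fun x a b =>
    (intervalIntegrable_const (c := (1 : ℝ))).mono_fun (hmm x).aestronglyMeasurable
      (ae_of_all _ fun v => by simpa using hm1 x v)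
  have hΦ : Tendsto (fun x => ∫ v in (0 : ℝ)..2, m x v) atTop (𝓝 0) := by
    have := intervalIntegral.tendsto_integral_filter_of_dominated_convergence
      (μ := volume) (a := 0) (b := 2) (F := m) (f := fun _ => 0) (l := atTop) (fun _ => (1 : ℝ))
      (Eventually.of_forall fun x => (hmm x).aestronglyMeasurable)
      (Eventually.of_forall fun x => ae_of_all _ fun v _ => hm1 x v)
      intervalIntegrable_const
      (ae_of_all _ fun v _ => by
        simpa [hmdef] using (tendsto_const_nhds (x := (1 : ℝ))).min (hlim v).abs)
    simpa using this
  -- Two averages are added below, hence the half. A total below `1` also shows that the truncation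
  -- is inactive.
  have hev := hΦ.eventually (gt_mem_nhds (by positivity : 0 < min δ 1 / 2))
  obtain ⟨X, hX⟩ := eventually_atTop.1 hev
  filter_upwards [eventually_ge_atTop X] with x hx u hu
  have h1 := hX x hx
  have h2 := hX (x + u) (by linarith [hu.1])
  have hmono : ∀ y a b, 0 ≤ a → a ≤ b → b ≤ 2 →
      ∫ v in a..b, m y v ≤ ∫ v in (0 : ℝ)..2, m y v := fun y a b ha hab hb =>
    intervalIntegral.integral_mono_interval ha hab hb (ae_of_all _ (hm0 y)) (hmi y 0 2)
  have hshift : ∫ v in u..(u + 1), m (x + u) (v - u) = ∫ v in (0 : ℝ)..1, m (x + u) v := by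
    rw [intervalIntegral.integral_comp_sub_right (fun v => m (x + u) v)]
    simp
  have hmi' : IntervalIntegrable (fun v => m (x + u) (v - u)) volume u (u + 1) := by
    have := (hmi (x + u) 0 1).comp_sub_right u
    simpa [add_comm] using this
  -- Both `h (x + u)` and `h x` are compared with `h (x + v)`, averaged over `v ∈ [u, u + 1] ⊆ [0,
  -- 2]`.
  have hkey : min 1 |h (x + u) - h x|
      ≤ ∫ v in u..(u + 1), (m x v + m (x + u) (v - u)) := by
    have hc : min 1 |h (x + u) - h x| = ∫ _v in u..(u + 1), min 1 |h (x + u) - h x| := by simp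
    rw [hc]
    refine intervalIntegral.integral_mono_on (by linarith) intervalIntegrable_const
      ((hmi x _ _).add hmi') fun v _ => ?_
    have e : h (x + u) - h x = (h (x + v) - h x) + -(h (x + u + (v - u)) - h (x + u)) := by
      rw [show x + u + (v - u) = x + v by ring]; ring
    rw [e]
    refine (min_one_abs_add_le _ _).trans ?_
    rw [abs_neg]
  rw [intervalIntegral.integral_add (hmi x _ _) hmi', hshift] at hkey
  have h3 := hmono x u (u + 1) hu.1 (by linarith) (by linarith [hu.2])
  have h4 := hmono (x + u) 0 1 le_rfl zero_le_one one_le_two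
  have h5 : min 1 |h (x + u) - h x| < min δ 1 := by linarith
  rcases min_lt_iff.1 (h5.trans_le (min_le_right _ _)) with h6 | h6
  · exact absurd h6 (lt_irrefl _)
  · rw [min_eq_right h6.le] at h5
    exact h5.trans_le (min_le_left _ _)

/-- Unit steps are chained; the `+ 1` pays for the final fractional step. -/
theorem exists_forall_abs_sub_le_mul_add_one {h : ℝ → ℝ} (hm : Measurable h)
    (hlim : ∀ u, Tendsto (fun x => h (x + u) - h x) atTop (𝓝 0)) {δ : ℝ} (hδ : 0 < δ) :
    ∃ X, ∀ x, X ≤ x → ∀ u, 0 ≤ u → |h (x + u) - h x| ≤ δ * (u + 1) := by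
  obtain ⟨X, hX⟩ := eventually_atTop.1 (eventually_forall_abs_sub_lt hm hlim hδ)
  have key : ∀ k : ℕ, ∀ x, X ≤ x → ∀ u ∈ Set.Icc (k : ℝ) (k + 1),
      |h (x + u) - h x| ≤ δ * (k + 1) := by
    intro k
    induction k with
    | zero =>
      intro x hx u hu
      simpa using (hX x hx u (by simpa using hu)).le
    | succ k ih =>
      intro x hx u hu
      push_cast at hu ⊢
      have h1 := ih (x + 1) (by linarith) (u - 1) ⟨by linarith [hu.1], by linarith [hu.2]⟩
      have h2 := (hX x hx 1 (by simp)).le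
      rw [show x + 1 + (u - 1) = x + u by ring] at h1
      have h3 : h (x + u) - h x = (h (x + u) - h (x + 1)) + (h (x + 1) - h x) := by ring
      rw [h3]
      refine (abs_add_le _ _).trans ?_
      linarith
  refine ⟨X, fun x hx u hu => (key ⌊u⌋₊ x hx u ⟨Nat.floor_le hu, (Nat.lt_floor_add_one u).le⟩).trans
    ?_⟩
  exact mul_le_mul_of_nonneg_left (by linarith [Nat.floor_le hu]) hδ.le

/-! ### Slowly varying functions and Potter's bounds. -/

theorem SlowlyVarying.eventually_ne_zero {L : ℝ → ℝ} (hL : SlowlyVarying L) :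
    ∀ᶠ x in atTop, L x ≠ 0 := by
  filter_upwards [(hL 1 one_pos).eventually_ne one_ne_zero] with x hx h0
  simp [h0] at hx

/-- A continuous function without zeros on a half-line keeps its sign there. -/
theorem SlowlyVarying.exists_forall_div_pos {L : ℝ → ℝ} (hL : SlowlyVarying L)
    (hc : ContinuousOn L (Set.Ioi 0)) :
    ∃ X, 0 < X ∧ ∀ s t, X ≤ s → X ≤ t → 0 < L s / L t := by
  obtain ⟨X, hX⟩ := eventually_atTop.1 (hL.eventually_ne_zero.and (eventually_gt_atTop 0))
  have hX0 : 0 < X := (hX X le_rfl).2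
  refine ⟨X, hX0, fun s t hs ht => ?_⟩
  have hcX : ContinuousOn L (Set.Ici X) := hc.mono fun x hx => hX0.trans_le hx
  have hIVT : ∀ s t, X ≤ s → X ≤ t → L s < 0 → ¬ 0 < L t := by
    intro s t hs ht hs' ht'
    obtain ⟨x, hx, hx0⟩ := isPreconnected_Ici.intermediate_value hs ht hcX ⟨hs'.le, ht'.le⟩
    exact (hX x hx).1 hx0
  rcases lt_or_gt_of_ne (hX s hs).1 with h1 | h1 <;> rcases lt_or_gt_of_ne (hX t ht).1 with h2 | h2
  · exact div_pos_of_neg_of_neg h1 h2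
  · exact absurd h2 (hIVT s t hs ht h1)
  · exact absurd h1 (hIVT t s ht hs h2)
  · exact div_pos h1 h2

/-- The substitution `h y = log (L (exp y))` makes slow variation additive. If `L` is negative,
`Real.log` reads `|L|`, which leaves the logarithm of the positive ratio unchanged. -/
theorem SlowlyVarying.exists_forall_abs_log_div_le {L : ℝ → ℝ} (hL : SlowlyVarying L)
    (hc : ContinuousOn L (Set.Ioi 0)) {δ : ℝ} (hδ : 0 < δ) :
    ∃ X, 0 < X ∧ ∀ s t, X ≤ s → s ≤ t →
      0 < L s / L t ∧ |Real.log (L s / L t)| ≤ δ * (Real.log (t / s) + 1) := by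
  obtain ⟨X₁, hX₁, hpos⟩ := hL.exists_forall_div_pos hc
  have hcexp : Continuous fun y => L (Real.exp y) :=
    hc.comp_continuous Real.continuous_exp Real.exp_pos
  have hlim : ∀ u, Tendsto (fun x => Real.log (L (Real.exp (x + u))) - Real.log (L (Real.exp x)))
      atTop (𝓝 0) := by
    intro u
    have h1 := (hL (Real.exp u) (Real.exp_pos u)).comp Real.tendsto_exp_atTop
    have h2 := h1.log one_ne_zero
    rw [Real.log_one] at h2
    refine h2.congr' ?_
    filter_upwards [h1.eventually_ne one_ne_zero] with x hx
    simp only [Function.comp_apply, ne_eq, div_eq_zero_iff, not_or] at hx ⊢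
    rw [Real.log_div hx.1 hx.2, Real.exp_add, mul_comm (Real.exp x)]
  obtain ⟨Y, hY⟩ := exists_forall_abs_sub_le_mul_add_one
    (Real.measurable_log.comp hcexp.measurable) hlim hδ
  refine ⟨max X₁ (Real.exp Y), lt_max_of_lt_left hX₁, fun s t hs hst => ?_⟩
  have hs1 : X₁ ≤ s := (le_max_left _ _).trans hs
  have hs2 : Real.exp Y ≤ s := (le_max_right _ _).trans hs
  have hs0 : 0 < s := hX₁.trans_le hs1
  have ht0 : 0 < t := hs0.trans_le hst
  have hp := hpos s t hs1 (hs1.trans hst)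
  refine ⟨hp, ?_⟩
  have h1 := hY (Real.log s) ((Real.le_log_iff_exp_le hs0).2 hs2) (Real.log (t / s))
    (Real.log_nonneg ((one_le_div hs0).2 hst))
  simp only [Function.comp_apply] at h1
  rw [Real.log_div ht0.ne' hs0.ne', add_sub_cancel, Real.exp_log hs0, Real.exp_log ht0,
    ← Real.log_div ht0.ne' hs0.ne', abs_sub_comm] at h1
  have hne := hp.ne'
  simp only [ne_eq, div_eq_zero_iff, not_or] at hne
  rwa [Real.log_div hne.1 hne.2]

theorem abs_exp_sub_one_le_mul_exp (w : ℝ) : |Real.exp w - 1| ≤ |w| * Real.exp |w| := by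
  rw [abs_le]
  have h1 := Real.add_one_le_exp w
  have h2 := Real.add_one_le_exp (-w)
  have h3 : Real.exp w ≤ Real.exp |w| := Real.exp_le_exp.2 (le_abs_self w)
  have h4 := Real.exp_pos w
  have h5 : Real.exp (-w) * Real.exp w = 1 := by rw [← Real.exp_add]; simp
  have h6 := abs_nonneg w
  have h7 : 1 ≤ Real.exp |w| := Real.one_le_exp h6
  constructor
  · nlinarith [neg_abs_le w]
  · have : Real.exp w - 1 ≤ w * Real.exp w := by nlinarith
    refine this.trans ?_
    calc w * Real.exp w ≤ |w| * Real.exp w := by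
          exact mul_le_mul_of_nonneg_right (le_abs_self w) h4.le
      _ ≤ _ := mul_le_mul_of_nonneg_left h3 h6

/-- A weighted form of **Potter's bounds**. -/
theorem exists_forall_abs_div_sub_rpow_le {θ : ℝ → ℝ} {α γ ε : ℝ} (hγ : γ < α)
    (hε : 0 < ε) (hc : ContinuousOn θ (Set.Ioi 0))
    (hL : SlowlyVarying fun x => θ x / x ^ α) :
    ∃ X, 0 < X ∧ θ X ≠ 0 ∧ ∀ s t, X ≤ s → s ≤ t →
      |θ s / θ t - (s / t) ^ α| ≤ ε * (s / t) ^ γ := by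
  have hLc : ContinuousOn (fun x => θ x / x ^ α) (Set.Ioi 0) := by
    refine hc.div (fun x hx => ?_) fun x hx => (Real.rpow_pos_of_pos hx α).ne'
    exact (Real.continuousAt_rpow_const x α (Or.inl (ne_of_gt hx))).continuousWithinAt
  -- The gap `α - γ` is spent in two halves: `y ^ (-κ)` absorbs the factor `v`, and `y ^ (-δ)` with
  -- `δ ≤ κ` absorbs `exp (δ v)`. The constants produced on the way make up `B`.
  set κ := (α - γ) / 2 with hκ
  have hκ0 : 0 < κ := by rw [hκ]; linarith
  set B := Real.exp 1 * (1 + 1 / κ) with hB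
  have hB0 : 0 < B := by positivity
  set δ := min (min κ 1) (ε / B) with hδ
  have hδ0 : 0 < δ := by positivity
  have hδκ : δ ≤ κ := (min_le_left _ _).trans (min_le_left _ _)
  have hδ1 : δ ≤ 1 := (min_le_left _ _).trans (min_le_right _ _)
  have hδε : δ * B ≤ ε := by
    rw [← le_div_iff₀ hB0]; exact min_le_right _ _
  obtain ⟨X, hX0, hX⟩ := hL.exists_forall_abs_log_div_le hLc hδ0
  refine ⟨X, hX0, ?_, fun s t hs hst => ?_⟩
  · have := (hX X X le_rfl le_rfl).1
    intro h0
    simp [h0] at this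
  obtain ⟨hp, hw⟩ := hX s t hs hst
  have hs0 : 0 < s := hX0.trans_le hs
  have ht0 : 0 < t := hs0.trans_le hst
  set y := s / t with hy
  have hy0 : 0 < y := div_pos hs0 ht0
  have hy1 : y ≤ 1 := (div_le_one ht0).2 hst
  set r := θ s / s ^ α / (θ t / t ^ α) with hr
  have hrθ : θ s / θ t = y ^ α * r := by
    rw [hr, hy, Real.div_rpow hs0.le ht0.le]
    have h1 := (Real.rpow_pos_of_pos hs0 α).ne'
    have h2 := (Real.rpow_pos_of_pos ht0 α).ne'
    by_cases h0 : θ t = 0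
    · simp [h0]
    · field_simp
  set v := Real.log (t / s) + 1 with hv
  have hvl : v = 1 - Real.log y := by
    rw [hv, hy, Real.log_div ht0.ne' hs0.ne', Real.log_div hs0.ne' ht0.ne']; ring
  have hv0 : 0 ≤ v := by
    have := Real.log_nonpos hy0.le hy1
    linarith
  have h1 : |r - 1| ≤ δ * v * Real.exp (δ * v) := by
    have h := abs_exp_sub_one_le_mul_exp (Real.log r)
    rw [Real.exp_log hp] at h
    refine h.trans ?_
    gcongr
  have h2 : Real.exp (δ * v) ≤ Real.exp 1 * y ^ (-δ) := by
    rw [Real.rpow_def_of_pos hy0, ← Real.exp_add]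
    refine Real.exp_le_exp.2 ?_
    rw [hvl]; linarith
  have h3 : v ≤ (1 + 1 / κ) * y ^ (-κ) := by
    have ha : Real.log y⁻¹ ≤ y⁻¹ ^ κ / κ := Real.log_le_rpow_div (by positivity) hκ0
    rw [Real.log_inv, Real.inv_rpow hy0.le, ← Real.rpow_neg hy0.le] at ha
    have hb : 1 ≤ y ^ (-κ) := Real.one_le_rpow_of_pos_of_le_one_of_nonpos hy0 hy1 (by linarith)
    rw [hvl, add_mul, one_mul, one_div_mul_eq_div]
    linarith
  have h4 : |r - 1| ≤ ε * (y ^ (-κ) * y ^ (-δ)) := by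
    calc |r - 1| ≤ δ * v * Real.exp (δ * v) := h1
      _ ≤ δ * ((1 + 1 / κ) * y ^ (-κ)) * (Real.exp 1 * y ^ (-δ)) := by gcongr
      _ = δ * B * (y ^ (-κ) * y ^ (-δ)) := by rw [hB]; ring
      _ ≤ ε * (y ^ (-κ) * y ^ (-δ)) := by gcongr
  rw [hrθ, show y ^ α * r - y ^ α = y ^ α * (r - 1) by ring, abs_mul,
    abs_of_pos (Real.rpow_pos_of_pos hy0 α)]
  calc y ^ α * |r - 1| ≤ y ^ α * (ε * (y ^ (-κ) * y ^ (-δ))) := by gcongr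
    _ = ε * y ^ (α + (-κ + -δ)) := by rw [Real.rpow_add hy0, Real.rpow_add hy0]; ring
    _ ≤ ε * y ^ γ := by
        refine mul_le_mul_of_nonneg_left ?_ hε.le
        exact Real.rpow_le_rpow_of_exponent_ge hy0 hy1 (by rw [hκ] at hδκ ⊢; linarith)

/-- Small primes give arguments `s = log p` that stay bounded, out of reach of the asymptotic
estimate. On `[a, X]` both terms are separately negligible: `θ s` is bounded while `1 / |θ t| = O(t
^ (-γ'))`, and `γ' > γ` leaves a spare negative power of `t`. -/
theorem eventually_forall_abs_div_sub_rpow_le {θ : ℝ → ℝ} {α γ ε a : ℝ} (hγ0 : 0 < γ) (hγ : γ < α)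
    (hε : 0 < ε) (ha : 0 < a) (hc : ContinuousOn θ (Set.Ioi 0))
    (hL : SlowlyVarying fun x => θ x / x ^ α) :
    ∀ᶠ t in atTop, ∀ s, a ≤ s → s ≤ t → |θ s / θ t - (s / t) ^ α| ≤ ε * (s / t) ^ γ := by
  obtain ⟨X, hX0, -, hX⟩ := exists_forall_abs_div_sub_rpow_le hγ hε hc hL
  set γ' := (α + γ) / 2 with hγ'
  have hγγ' : γ < γ' := by rw [hγ']; linarith
  obtain ⟨Y, hY0, hYne, hY⟩ := exists_forall_abs_div_sub_rpow_le (γ := γ') (by rw [hγ']; linarith)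
    one_pos hc hL
  obtain ⟨M, hM⟩ := (isCompact_Icc (a := a) (b := X)).exists_bound_of_continuousOn
    (hc.mono fun x hx => ha.trans_le hx.1)
  have hlim1 : Tendsto (fun t : ℝ => M / |θ Y| * (2 * Y ^ γ') / a ^ γ * t ^ (-(γ' - γ))) atTop
      (𝓝 0) := by
    simpa using (tendsto_rpow_neg_atTop (by linarith : 0 < γ' - γ)).const_mul
      (M / |θ Y| * (2 * Y ^ γ') / a ^ γ)
  have hlim2 : Tendsto (fun t : ℝ => X ^ (α - γ) * t ^ (-(α - γ))) atTop (𝓝 0) := by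
    simpa using (tendsto_rpow_neg_atTop (by linarith : 0 < α - γ)).const_mul (X ^ (α - γ))
  filter_upwards [hlim1.eventually (gt_mem_nhds (half_pos hε)),
    hlim2.eventually (gt_mem_nhds (half_pos hε)), eventually_ge_atTop Y, eventually_gt_atTop 0]
    with t h1 h2 htY ht0 s has hst
  rcases le_total X s with hXs | hXs
  · exact hX s t hXs hst
  have hs0 : 0 < s := ha.trans_le has
  set y := s / t with hy
  have hy0 : 0 < y := div_pos hs0 ht0
  have hM' : |θ s| ≤ M := hM s ⟨has, hXs⟩
  have hM0 : 0 ≤ M := (abs_nonneg _).trans hM'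
  have hYt : |θ Y / θ t| ≤ 2 * Y ^ γ' * t ^ (-γ') := by
    have h3 := hY Y t le_rfl htY
    have hz0 : 0 < Y / t := div_pos hY0 ht0
    have h4 : (Y / t) ^ α ≤ (Y / t) ^ γ' := Real.rpow_le_rpow_of_exponent_ge hz0
      ((div_le_one ht0).2 htY) (by rw [hγ']; linarith)
    have h5 : |θ Y / θ t| ≤ |θ Y / θ t - (Y / t) ^ α| + |(Y / t) ^ α| := by
      simpa using abs_add_le (θ Y / θ t - (Y / t) ^ α) ((Y / t) ^ α)
    rw [abs_of_pos (Real.rpow_pos_of_pos hz0 _)] at h5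
    have h6 : (Y / t) ^ γ' = Y ^ γ' * t ^ (-γ') := by
      rw [Real.div_rpow hY0.le ht0.le, Real.rpow_neg ht0.le]; rfl
    rw [h6] at h3 h4
    linarith
  have hst1 : |θ s / θ t| ≤ ε / 2 * y ^ γ := by
    have h3 : |θ s / θ t| ≤ M / |θ Y| * |θ Y / θ t| := by
      rw [abs_div, abs_div]
      have := abs_pos.2 hYne
      rw [div_mul_div_comm, mul_comm |θ Y|, mul_div_mul_right _ _ this.ne']
      gcongr
    have h4 : (a / t) ^ γ ≤ y ^ γ := by
      refine Real.rpow_le_rpow (by positivity) ?_ hγ0.le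
      rw [hy]; gcongr
    calc |θ s / θ t| ≤ M / |θ Y| * (2 * Y ^ γ' * t ^ (-γ')) :=
          h3.trans (mul_le_mul_of_nonneg_left hYt (by positivity))
      _ = (M / |θ Y| * (2 * Y ^ γ') / a ^ γ * t ^ (-(γ' - γ))) * (a / t) ^ γ := by
          rw [Real.div_rpow ha.le ht0.le, show -(γ' - γ) = -γ' + γ by ring, Real.rpow_add ht0]
          have e1 := (Real.rpow_pos_of_pos ha γ).ne'
          have e2 := (Real.rpow_pos_of_pos ht0 γ).ne'
          field_simp
      _ ≤ ε / 2 * y ^ γ := by gcongr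
  have hst2 : y ^ α ≤ ε / 2 * y ^ γ := by
    calc y ^ α = y ^ (α - γ) * y ^ γ := by rw [← Real.rpow_add hy0]; congr 1; ring
      _ ≤ (X ^ (α - γ) * t ^ (-(α - γ))) * y ^ γ := by
          refine mul_le_mul_of_nonneg_right ?_ (by positivity)
          rw [hy, Real.div_rpow hs0.le ht0.le, Real.rpow_neg ht0.le, div_eq_mul_inv]
          refine mul_le_mul_of_nonneg_right ?_ (by positivity)
          exact Real.rpow_le_rpow hs0.le hXs (by linarith)
      _ ≤ ε / 2 * y ^ γ := by gcongr
  refine (abs_sub _ _).trans ?_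
  rw [abs_of_pos (Real.rpow_pos_of_pos hy0 α)]
  linarith

/-! ### Characteristic functional of a Poisson random measure -/

theorem lintegral_natCast_poissonMeasure (r : ℝ≥0) :
    ∫⁻ k : ℕ, (k : ℝ≥0∞) ∂(poissonMeasure r) = r := by
  rw [lintegral_countable', tsum_eq_zero_add' ENNReal.summable]
  have hstep : ∀ n : ℕ, ((n + 1 : ℕ) : ℝ≥0∞) * poissonMeasure r {n + 1}
      = r * poissonMeasure r {n} := by
    intro n
    rw [poissonMeasure_singleton, poissonMeasure_singleton, ← ENNReal.ofReal_natCast,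
      ← ENNReal.ofReal_coe_nnreal, ← ENNReal.ofReal_mul (by positivity),
      ← ENNReal.ofReal_mul (by positivity)]
    congr 1
    rw [Nat.factorial_succ]
    push_cast
    field_simp
    ring
  simp only [hstep, ENNReal.tsum_mul_left]
  have h1 : ∑' n : ℕ, poissonMeasure r {n} = 1 := by
    have := lintegral_countable' (μ := poissonMeasure r) (fun _ => (1 : ℝ≥0∞))
    simpa using this.symm
  simp [h1]

theorem norm_cexp_mul_I_sub_le (a b : ℝ) :
    ‖Complex.exp (a * Complex.I) - Complex.exp (b * Complex.I)‖ ≤ |a - b| := by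
  have h : Complex.exp (a * Complex.I) - Complex.exp (b * Complex.I)
      = Complex.exp (b * Complex.I) * (Complex.exp (Complex.I * (a - b : ℝ)) - 1) := by
    rw [mul_sub, ← Complex.exp_add, mul_one]
    congr 2
    push_cast; ring
  rw [h, norm_mul, Complex.norm_exp_ofReal_mul_I, one_mul]
  exact Real.norm_exp_I_mul_ofReal_sub_one_le

theorem norm_cexp_mul_I_sub_one_le (a : ℝ) : ‖Complex.exp (a * Complex.I) - 1‖ ≤ |a| := by
  simpa using norm_cexp_mul_I_sub_le a 0

theorem integrable_cexp_mul_I_sub_one {E : Type*} [MeasurableSpace E] {μ : Measure E} {f : E → ℝ}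
    (hf : Integrable f μ) : Integrable (fun z => Complex.exp (f z * Complex.I) - 1) μ := by
  refine hf.mono ?_ (ae_of_all _ fun z => norm_cexp_mul_I_sub_one_le _)
  have h : Continuous fun a : ℝ => Complex.exp (a * Complex.I) - 1 := by fun_prop
  exact h.comp_aestronglyMeasurable hf.aestronglyMeasurable

namespace IsPoissonRandomMeasure

variable {Ω E : Type*} [MeasurableSpace Ω] [MeasurableSpace E] {P : Measure Ω} {η : Ω → Measure E} {μ : Measure E}

theorem measurable_apply (hη : IsPoissonRandomMeasure P η μ) {B : Set E} (hB : MeasurableSet B) :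
    Measurable fun ω => η ω B :=
  (Measure.measurable_coe hB).comp hη.measurable

theorem charFun_map_real (hη : IsPoissonRandomMeasure P η μ) {B : Set E} (hB : MeasurableSet B)
    (hμ : μ B ≠ ∞) (t : ℝ) :
    charFun (P.map fun ω => (η ω).real B) t
      = Complex.exp (μ.real B * (Complex.exp (t * Complex.I) - 1)) := by
  have h1 : (P.map fun ω => (η ω).real B)
      = (poissonMeasure (μ B).toNNReal).map (Nat.cast : ℕ → ℝ) := by
    have : (fun ω => (η ω).real B) = ENNReal.toReal ∘ fun ω => η ω B := rfl
    rw [this, ← Measure.map_map ENNReal.measurable_toReal (hη.measurable_apply hB),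
      hη.law_of_ne_top B hB hμ, Measure.map_map ENNReal.measurable_toReal .of_discrete]
    congr 1
  rw [h1, charFun_map_cast_poissonMeasure]
  rfl

variable [IsProbabilityMeasure P]

/-- Since the mean measure of `η` is `μ`, bounds in `L¹(μ)` transfer to expected integrals against
`η`. -/
theorem bind_eq (hη : IsPoissonRandomMeasure P η μ) : P.bind η = μ := by
  ext B hB
  rw [Measure.bind_apply hB hη.measurable.aemeasurable]
  by_cases h : μ B = ∞
  · rw [h, lintegral_congr_ae (hη.eq_top B hB h)]
    simp
  · have h1 : ∫⁻ ω, η ω B ∂P = ∫⁻ x, x ∂(P.map fun ω => η ω B) := by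
      rw [lintegral_map (f := fun x => x) measurable_id (hη.measurable_apply hB)]
    rw [h1, hη.law_of_ne_top B hB h, lintegral_map (f := fun x => x) measurable_id
      .of_discrete, lintegral_natCast_poissonMeasure, ENNReal.coe_toNNReal h]

theorem lintegral_lintegral (hη : IsPoissonRandomMeasure P η μ) {f : E → ℝ≥0∞}
    (hf : Measurable f) : ∫⁻ ω, ∫⁻ z, f z ∂(η ω) ∂P = ∫⁻ z, f z ∂μ := by
  rw [← hη.bind_eq, Measure.lintegral_bind hη.measurable.aemeasurable hf.aemeasurable]

theorem ae_integrable (hη : IsPoissonRandomMeasure P η μ) {f : E → ℝ} (hf : Measurable f)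
    (hfi : Integrable f μ) : ∀ᵐ ω ∂P, Integrable f (η ω) := by
  have h1 := hη.lintegral_lintegral hf.enorm
  have h2 : Measurable fun ω => ∫⁻ z, ‖f z‖ₑ ∂(η ω) :=
    (Measure.measurable_lintegral hf.enorm).comp hη.measurable
  filter_upwards [ae_lt_top h2 (h1.trans_lt hfi.2).ne] with ω hω
  exact ⟨hf.aestronglyMeasurable, hω⟩

/-- Measurability is known for lower integrals. Their difference agrees with the Bochner integral
where `f` is integrable, hence only almost everywhere. -/
theorem aemeasurable_integral (hη : IsPoissonRandomMeasure P η μ) {f : E → ℝ} (hf : Measurable f)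
    (hfi : Integrable f μ) : AEMeasurable (fun ω => ∫ z, f z ∂(η ω)) P := by
  have h : ∀ {g : E → ℝ≥0∞}, Measurable g → Measurable fun ω => (∫⁻ z, g z ∂(η ω)).toReal :=
    fun hg => ((Measure.measurable_lintegral hg).comp hη.measurable).ennreal_toReal
  refine ((h hf.ennreal_ofReal).sub (h hf.neg.ennreal_ofReal)).aemeasurable.congr ?_
  filter_upwards [hη.ae_integrable hf hfi] with ω hω
  exact (integral_eq_lintegral_pos_part_sub_lintegral_neg_part hω).symm

/-- The integral of a simple function is a finite combination of independent Poisson counts of its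
level sets. -/
theorem charFun_simpleFunc (hη : IsPoissonRandomMeasure P η μ) (g : SimpleFunc E ℝ)
    (hg : Integrable g μ) :
    ∫ ω, Complex.exp ((∫ z, g z ∂(η ω) : ℝ) * Complex.I) ∂P
      = Complex.exp (∫ z, (Complex.exp (g z * Complex.I) - 1) ∂μ) := by
  classical
  -- The value `0` is dropped: its level set may have infinite intensity.
  set s : Finset ℝ := {x ∈ g.range | x ≠ 0} with hs
  set e := s.equivFin with he
  set B : Fin s.card → Set E := fun i => g ⁻¹' {((e.symm i : s) : ℝ)} with hB
  have hBm : ∀ i, MeasurableSet (B i) := fun i => g.measurableSet_fiber _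
  have hdisj : Pairwise fun i j => Disjoint (B i) (B j) := by
    intro i j hij
    refine Disjoint.preimage _ (Set.disjoint_singleton.2 fun h => hij ?_)
    exact e.symm.injective (Subtype.ext h)
  have hfin : ∀ i, μ (B i) ≠ ∞ := fun i =>
    ((SimpleFunc.integrable_iff.1 hg) _ (Finset.mem_filter.1 (e.symm i).2).2).ne
  set X : Fin s.card → Ω → ℝ := fun i ω => ((e.symm i : s) : ℝ) * (η ω).real (B i) with hX
  have hrm : ∀ i, Measurable fun ω => (η ω).real (B i) :=
    fun i => (hη.measurable_apply (hBm i)).ennreal_toReal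
  have hXm : ∀ i, AEMeasurable (X i) P := fun i => ((hrm i).const_mul _).aemeasurable
  have hind : iIndepFun X P :=
    (hη.indep _ B hBm hdisj).comp (fun i x => ((e.symm i : s) : ℝ) * x.toReal)
      fun i => ENNReal.measurable_toReal.const_mul _
  have hsum : ∀ {F : Type} [AddCommMonoid F] (φ : ℝ → F),
      ∑ i, φ ((e.symm i : s) : ℝ) = ∑ x ∈ s, φ x := by
    intro F _ φ
    rw [← Finset.sum_coe_sort s]
    exact e.symm.sum_comp fun x : s => φ x
  have hint : ∀ᵐ ω ∂P, ∫ z, g z ∂(η ω) = ∑ i, X i ω := by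
    filter_upwards [hη.ae_integrable g.measurable hg] with ω hω
    rw [← SimpleFunc.integral_eq_integral g hω, SimpleFunc.integral_eq_sum_filter,
      ← hsum fun x => (η ω).real (g ⁻¹' {x}) • x]
    exact Finset.sum_congr rfl fun i _ => by simp [hX, hB, mul_comm]
  have hchar : ∀ i, charFun (P.map (X i)) 1
      = Complex.exp (μ.real (B i) * (Complex.exp (((e.symm i : s) : ℝ) * Complex.I) - 1)) := by
    intro i
    rw [charFun_map_mul_comp (hrm i).aemeasurable, mul_one, hη.charFun_map_real (hBm i) (hfin i)]
  have hlhs : ∫ ω, Complex.exp ((∫ z, g z ∂(η ω) : ℝ) * Complex.I) ∂P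
      = charFun (P.map fun ω => ∑ i, X i ω) 1 := by
    rw [charFun_apply_real, integral_map (Finset.aemeasurable_fun_sum _ fun i _ => hXm i)
      (by fun_prop)]
    refine integral_congr_ae ?_
    filter_upwards [hint] with ω hω
    rw [hω]
    simp
  rw [hlhs, hind.charFun_map_fun_sum_eq_prod hXm, Finset.prod_apply,
    Finset.prod_congr rfl fun i _ => hchar i, ← Complex.exp_sum]
  congr 1
  have hφ0 : (fun x : ℝ => Complex.exp (x * Complex.I) - 1) 0 = 0 := by simp
  have h1 : ∫ z, (Complex.exp (g z * Complex.I) - 1) ∂μ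
      = (g.map fun x : ℝ => Complex.exp (x * Complex.I) - 1).integral μ := by
    rw [SimpleFunc.integral_eq_integral]
    · rfl
    · exact integrable_cexp_mul_I_sub_one hg
  rw [h1, SimpleFunc.map_integral _ _ hg hφ0,
    hsum fun x : ℝ => (μ.real (g ⁻¹' {x}) : ℂ) * (Complex.exp (x * Complex.I) - 1), hs,
    Finset.sum_filter_of_ne]
  · rfl
  · intro x _ hx h0
    simp [h0] at hx

/-- **Campbell's formula** for the characteristic function of `∫ f dη`. -/
theorem integral_cexp_integral (hη : IsPoissonRandomMeasure P η μ) {f : E → ℝ} (hf : Measurable f)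
    (hfi : Integrable f μ) :
    ∫ ω, Complex.exp ((∫ z, f z ∂(η ω) : ℝ) * Complex.I) ∂P
      = Complex.exp (∫ z, (Complex.exp (f z * Complex.I) - 1) ∂μ) := by
  -- The left side and the exponent on the right are both 1-Lipschitz in `f` for the `L¹(μ)` norm,
  -- so simple functions suffice.
  have happrox : ∀ k : ℕ, ∃ g : SimpleFunc E ℝ,
      ∫⁻ z, ‖f z - g z‖ₑ ∂μ < ENNReal.ofReal (1 / ((k : ℝ) + 1)) ∧ Integrable g μ := by
    intro k
    obtain ⟨g, hg, hgm⟩ := (memLp_one_iff_integrable.2 hfi).exists_simpleFunc_eLpNorm_sub_lt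
      ENNReal.one_ne_top (ε := ENNReal.ofReal (1 / ((k : ℝ) + 1)))
      (ENNReal.ofReal_pos.2 (by positivity)).ne'
    rw [eLpNorm_one_eq_lintegral_enorm] at hg
    exact ⟨g, hg, memLp_one_iff_integrable.1 hgm⟩
  choose g hg hgi using happrox
  have hzero : Tendsto (fun k : ℕ => ENNReal.ofReal (1 / ((k : ℝ) + 1))) atTop (𝓝 0) := by
    simpa using ENNReal.tendsto_ofReal tendsto_one_div_add_atTop_nhds_zero_nat
  have hexp : ∀ {f : E → ℝ}, Measurable f → Integrable f μ →
      Integrable (fun ω => Complex.exp ((∫ z, f z ∂(η ω) : ℝ) * Complex.I)) P := by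
    intro f hf hfi
    have hc : Continuous fun a : ℝ => Complex.exp (a * Complex.I) := by fun_prop
    refine Integrable.of_bound (C := 1) (hc.comp_aestronglyMeasurable
      (hη.aemeasurable_integral hf hfi).aestronglyMeasurable) (ae_of_all _ fun ω => ?_)
    simp only [Complex.norm_exp_ofReal_mul_I, le_refl]
  have hl : Tendsto (fun k => ∫ ω, Complex.exp ((∫ z, g k z ∂(η ω) : ℝ) * Complex.I) ∂P) atTop
      (𝓝 (∫ ω, Complex.exp ((∫ z, f z ∂(η ω) : ℝ) * Complex.I) ∂P)) := by
    rw [tendsto_iff_edist_tendsto_0]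
    refine tendsto_of_tendsto_of_tendsto_of_le_of_le tendsto_const_nhds hzero
      (fun _ => zero_le) fun k => ?_
    rw [edist_comm, edist_eq_enorm_sub,
      ← integral_sub (hexp hf hfi) (hexp (g k).measurable (hgi k))]
    refine (enorm_integral_le_lintegral_enorm _).trans ?_
    refine le_trans ?_ (hg k).le
    rw [← hη.lintegral_lintegral (f := fun z => ‖f z - g k z‖ₑ) (hf.sub (g k).measurable).enorm]
    refine lintegral_mono_ae ?_
    filter_upwards [hη.ae_integrable hf hfi, hη.ae_integrable (g k).measurable (hgi k)]
      with ω h1 h2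
    refine le_trans ?_ (enorm_integral_le_lintegral_enorm _)
    rw [integral_sub h1 h2]
    exact enorm_le_iff_norm_le.2 (norm_cexp_mul_I_sub_le _ _)
  have hr : Tendsto (fun k => ∫ z, (Complex.exp (g k z * Complex.I) - 1) ∂μ) atTop
      (𝓝 (∫ z, (Complex.exp (f z * Complex.I) - 1) ∂μ)) := by
    rw [tendsto_iff_edist_tendsto_0]
    refine tendsto_of_tendsto_of_tendsto_of_le_of_le tendsto_const_nhds hzero
      (fun _ => zero_le) fun k => ?_
    rw [edist_comm, edist_eq_enorm_sub, ← integral_sub (integrable_cexp_mul_I_sub_one hfi)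
      (integrable_cexp_mul_I_sub_one (hgi k))]
    refine (enorm_integral_le_lintegral_enorm _).trans (le_trans ?_ (hg k).le)
    refine lintegral_mono fun z => ?_
    rw [sub_sub_sub_cancel_right]
    exact enorm_le_iff_norm_le.2 (norm_cexp_mul_I_sub_le _ _)
  refine tendsto_nhds_unique hl ?_
  simp_rw [fun k => hη.charFun_simpleFunc (g k) (hgi k)]
  exact (Complex.continuous_exp.tendsto _).comp hr

end IsPoissonRandomMeasure

/-! ### The characteristic function of a geometric sum -/

theorem norm_prod_sub_prod_le_sum {ι : Type*} (s : Finset ι) {a b : ι → ℂ}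
    (ha : ∀ i ∈ s, ‖a i‖ ≤ 1) (hb : ∀ i ∈ s, ‖b i‖ ≤ 1) :
    ‖∏ i ∈ s, a i - ∏ i ∈ s, b i‖ ≤ ∑ i ∈ s, ‖a i - b i‖ := by
  classical
  induction s using Finset.induction_on with
  | empty => simp
  | insert i s hi ih =>
    rw [Finset.prod_insert hi, Finset.prod_insert hi, Finset.sum_insert hi]
    have h1 := ih (fun j hj => ha j (Finset.mem_insert_of_mem hj))
      (fun j hj => hb j (Finset.mem_insert_of_mem hj))
    have h2 : ‖∏ j ∈ s, b j‖ ≤ 1 := by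
      rw [norm_prod]
      exact Finset.prod_le_one (fun _ _ => norm_nonneg _)
        fun j hj => hb j (Finset.mem_insert_of_mem hj)
    have h3 : a i * ∏ j ∈ s, a j - b i * ∏ j ∈ s, b j
        = (a i - b i) * ∏ j ∈ s, b j + a i * (∏ j ∈ s, a j - ∏ j ∈ s, b j) := by ring
    rw [h3]
    refine (norm_add_le _ _).trans ?_
    rw [norm_mul, norm_mul]
    have h4 := ha i (Finset.mem_insert_self i s)
    have h5 := mul_le_mul_of_nonneg_left h2 (norm_nonneg (a i - b i))
    have h6 := mul_le_mul h4 h1 (norm_nonneg _) zero_le_one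
    linarith

theorem sub_one_le_norm_natCast_sub {p : ℕ} {z : ℂ} (hz : ‖z‖ = 1) :
    (p : ℝ) - 1 ≤ ‖(p : ℂ) - z‖ := by
  have := norm_sub_norm_le (p : ℂ) z
  rwa [hz, Complex.norm_natCast] at this

/-- Both expressions are `1 + (z - 1) / p` up to `2 ‖z - 1‖ / p²`. Keeping the factor `‖z - 1‖` is
what makes the summed error vanish rather than merely stay bounded. -/
theorem norm_geometric_factor_sub_exp_le {p : ℕ} (hp : 2 ≤ p) {z : ℂ} (hz : ‖z‖ = 1) :
    ‖((p : ℂ) - 1) / (p - z) - Complex.exp ((z - 1) / p)‖ ≤ 4 * ‖z - 1‖ / (p : ℝ) ^ 2 := by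
  have hp' : (2 : ℝ) ≤ p := by exact_mod_cast hp
  have hp0 : (p : ℂ) ≠ 0 := by exact_mod_cast (by omega : p ≠ 0)
  have hpz := sub_one_le_norm_natCast_sub (p := p) hz
  have hpz0 : (p : ℂ) - z ≠ 0 := norm_pos_iff.1 (by linarith)
  have hz1 : ‖z - 1‖ ≤ 2 := (norm_sub_le _ _).trans (by rw [hz]; norm_num)
  have hw : ‖(z - 1) / p‖ = ‖z - 1‖ / p := by rw [norm_div, Complex.norm_natCast]
  have h1 : ‖Complex.exp ((z - 1) / p) - 1 - (z - 1) / p‖ ≤ 2 * ‖z - 1‖ / (p : ℝ) ^ 2 := by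
    refine (Complex.norm_exp_sub_one_sub_id_le ?_).trans ?_
    · rw [hw, div_le_one (by linarith)]; linarith
    · rw [hw, div_pow]
      gcongr
      nlinarith [norm_nonneg (z - 1)]
  have h2 : ‖((p : ℂ) - 1) / (p - z) - 1 - (z - 1) / p‖ ≤ 2 * ‖z - 1‖ / (p : ℝ) ^ 2 := by
    have e : ((p : ℂ) - 1) / (p - z) - 1 - (z - 1) / p = (z - 1) * z / (p * (p - z)) := by
      field_simp
      ring
    rw [e, norm_div, norm_mul, norm_mul, hz, mul_one, Complex.norm_natCast,
      div_le_div_iff₀ (by nlinarith) (by nlinarith)]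
    have h3 : (p : ℝ) ^ 2 ≤ 2 * (p * ‖(p : ℂ) - z‖) := by nlinarith
    nlinarith [mul_le_mul_of_nonneg_left h3 (norm_nonneg (z - 1))]
  have e : ((p : ℂ) - 1) / (p - z) - Complex.exp ((z - 1) / p)
      = (((p : ℂ) - 1) / (p - z) - 1 - (z - 1) / p)
        - (Complex.exp ((z - 1) / p) - 1 - (z - 1) / p) := by ring
  rw [e]
  refine (norm_sub_le _ _).trans ?_
  have : 4 * ‖z - 1‖ / (p : ℝ) ^ 2 = 2 * ‖z - 1‖ / (p : ℝ) ^ 2 + 2 * ‖z - 1‖ / (p : ℝ) ^ 2 := by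
    ring
  linarith

theorem norm_prod_geometric_factor_sub_exp_le (n : ℕ) {z : ℕ → ℂ} (hz : ∀ p, ‖z p‖ = 1) :
    ‖∏ p ∈ Nat.primesLE n, ((p : ℂ) - 1) / (p - z p)
        - Complex.exp (∑ p ∈ Nat.primesLE n, (1 / p : ℝ) • (z p - 1))‖
      ≤ ∑ p ∈ Nat.primesLE n, 4 * ‖z p - 1‖ / (p : ℝ) ^ 2 := by
  rw [Complex.exp_sum]
  refine (norm_prod_sub_prod_le_sum _ (fun p hp => ?_) fun p hp => ?_).trans
    (Finset.sum_le_sum fun p hp => ?_)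
  · have h2 : (2 : ℝ) ≤ p := by exact_mod_cast Nat.two_le_of_mem_primesLE hp
    have h1 := sub_one_le_norm_natCast_sub (p := p) (hz p)
    rw [norm_div, div_le_one (by linarith)]
    have : ‖(p : ℂ) - 1‖ = (p : ℝ) - 1 := by
      rw [← Nat.cast_one, ← Nat.cast_sub (by exact_mod_cast (by linarith : (1 : ℝ) ≤ p)),
        Complex.norm_natCast, Nat.cast_sub (by exact_mod_cast (by linarith : (1 : ℝ) ≤ p)), Nat.cast_one]
    rwa [this]
  · rw [Complex.norm_exp, Real.exp_le_one_iff, Complex.smul_re, smul_eq_mul]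
    refine mul_nonpos_of_nonneg_of_nonpos (by positivity) ?_
    have := Complex.re_le_norm (z p)
    rw [hz p] at this
    simpa using this
  · have h := norm_geometric_factor_sub_exp_le (Nat.two_le_of_mem_primesLE hp) (hz p)
    have e : (1 / p : ℝ) • (z p - 1) = (z p - 1) / p := by
      rw [Complex.real_smul]; push_cast; ring
    rwa [e]

namespace IsGeometricPrimeFamily

variable {Ω : Type*} [MeasurableSpace Ω] {P : Measure Ω} [IsProbabilityMeasure P] {ε : ℕ → Ω → ℕ}

theorem charFun_map_const_mul (hε : IsGeometricPrimeFamily P ε) {p : ℕ} (hp : p.Prime) (c t : ℝ) :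
    charFun (P.map fun ω => c * (ε p ω : ℝ)) t
      = ((p : ℂ) - 1) / (p - Complex.exp ((t * c : ℝ) * Complex.I)) := by
  have hm := hε.measurable p hp
  have hp2 : (2 : ℝ) ≤ p := by exact_mod_cast hp.two_le
  have hp0 : (p : ℂ) ≠ 0 := by exact_mod_cast hp.ne_zero
  set z := Complex.exp ((t * c : ℝ) * Complex.I) with hz
  have hz1 : ‖z‖ = 1 := Complex.norm_exp_ofReal_mul_I _
  have hpz0 : (p : ℂ) - z ≠ 0 :=
    norm_pos_iff.1 (by linarith [sub_one_le_norm_natCast_sub (p := p) hz1])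
  have : IsProbabilityMeasure (P.map (ε p)) := Measure.isProbabilityMeasure_map hm.aemeasurable
  have h1 : charFun (P.map fun ω => c * (ε p ω : ℝ)) t = ∫ m : ℕ, z ^ m ∂(P.map (ε p)) := by
    rw [charFun_apply_real, integral_map (by fun_prop) (by fun_prop),
      integral_map hm.aemeasurable (by fun_prop)]
    refine integral_congr_ae (ae_of_all _ fun ω => ?_)
    simp only [hz, ← Complex.exp_nat_mul]
    congr 1
    push_cast
    ring
  have hint : Integrable (fun m : ℕ => z ^ m) (P.map (ε p)) :=
    Integrable.of_bound (C := 1) (by fun_prop) (ae_of_all _ fun m => by simp [hz1])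
  have hmass : ∀ m : ℕ, (P.map (ε p)).real {m} = (1 - 1 / (p : ℝ)) * ((p : ℝ) ^ m)⁻¹ := by
    intro m
    rw [measureReal_def, Measure.map_apply hm (measurableSet_singleton m)]
    have := hε.law p hp m
    rw [show ε p ⁻¹' {m} = {ω | ε p ω = m} from rfl, this, ENNReal.toReal_ofReal]
    have : 1 / (p : ℝ) ≤ 1 := by rw [div_le_one (by linarith)]; linarith
    exact mul_nonneg (by linarith) (by positivity)
  rw [h1, integral_countable hint]
  have hterm : ∀ m : ℕ, (P.map (ε p)).real {m} • z ^ m = (1 - 1 / (p : ℂ)) * (z / p) ^ m := by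
    intro m
    rw [hmass, Complex.real_smul]
    push_cast
    rw [div_pow]
    ring
  simp only [hterm]
  rw [tsum_mul_left, tsum_geometric_of_norm_lt_one]
  · field_simp
  · rw [norm_div, hz1, Complex.norm_natCast, div_lt_one (by linarith)]
    linarith

theorem charFun_map_sum (hε : IsGeometricPrimeFamily P ε) (n : ℕ) (c : ℕ → ℝ) (t : ℝ) :
    charFun (P.map fun ω => ∑ p ∈ Nat.primesLE n, c p * (ε p ω : ℝ)) t
      = ∏ p ∈ Nat.primesLE n, ((p : ℂ) - 1) / (p - Complex.exp ((t * c p : ℝ) * Complex.I)) := by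
  have hind : iIndepFun
      ((Nat.primesLE n).restrict fun p ω => c p * (ε p ω : ℝ)) P := by
    have h1 := hε.indep.precomp
      (g := fun p : Nat.primesLE n => (⟨p, Nat.prime_of_mem_primesLE p.2⟩ : {p : ℕ // p.Prime}))
      (fun p q h => Subtype.ext (Subtype.mk.inj h))
    exact h1.comp (fun p m => c p * (m : ℝ)) fun p => .of_discrete
  have hm : ∀ p ∈ Nat.primesLE n, AEMeasurable (fun ω => c p * (ε p ω : ℝ)) P := fun p hp => by
    have := hε.measurable p (Nat.prime_of_mem_primesLE hp)
    fun_prop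
  rw [iIndepFun.charFun_map_fun_finsetSum_eq_prod hm hind, Finset.prod_apply]
  exact Finset.prod_congr rfl fun p hp =>
    hε.charFun_map_const_mul (Nat.prime_of_mem_primesLE hp) (c p) t

end IsGeometricPrimeFamily

/-! ### Integration against the Dickman intensity -/

theorem measurable_dickmanDensity :
    Measurable fun z : DickmanSpace => ENNReal.ofReal (1 / (z.2 : ℝ)) := by fun_prop

instance isProbabilityMeasure_comap_Ioc :
    IsProbabilityMeasure ((volume : Measure ℝ).comap ((↑) : ↥(Set.Ioc (0 : ℝ) 1) → ℝ)) := by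
  constructor
  rw [comap_subtype_coe_apply measurableSet_Ioc, Set.image_univ, Subtype.range_coe]
  simp

theorem toReal_dickmanDensity (z : DickmanSpace) :
    (ENNReal.ofReal (1 / (z.2 : ℝ))).toReal = 1 / (z.2 : ℝ) :=
  ENNReal.toReal_ofReal (one_div_nonneg.2 z.2.2.1.le)

/-- The integrand ignores the first coordinate, whose marginal has mass `1`. -/
theorem integral_dickmanIntensity (G : ℝ → ℂ) :
    ∫ z : DickmanSpace, G z.2 ∂dickmanIntensity = ∫ x in Set.Ioc (0 : ℝ) 1, (1 / x) • G x := by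
  rw [dickmanIntensity, integral_withDensity_eq_integral_toReal_smul measurable_dickmanDensity
    (ae_of_all _ fun _ => ENNReal.ofReal_lt_top)]
  simp only [toReal_dickmanDensity]
  rw [integral_fun_snd (fun x : Set.Ioc (0 : ℝ) 1 => (1 / (x : ℝ)) • G x)]
  simp only [probReal_univ, one_smul]
  exact integral_subtype_comap measurableSet_Ioc fun x => (1 / x) • G x

theorem integrable_rpow_dickmanIntensity {α : ℝ} (hα : 0 < α) :
    Integrable (fun z : DickmanSpace => (z.2 : ℝ) ^ α) dickmanIntensity := by
  rw [dickmanIntensity, integrable_withDensity_iff_integrable_smul' measurable_dickmanDensity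
    (ae_of_all _ fun _ => ENNReal.ofReal_lt_top)]
  simp only [toReal_dickmanDensity]
  have h1 : Integrable (fun x : Set.Ioc (0 : ℝ) 1 => (x : ℝ) ^ (α - 1))
      ((volume : Measure ℝ).comap ((↑) : ↥(Set.Ioc (0 : ℝ) 1) → ℝ)) := by
    have := integrableOn_rpow_sub_one hα
    rw [IntegrableOn, ← map_comap_subtype_coe measurableSet_Ioc,
      (MeasurableEmbedding.subtype_coe measurableSet_Ioc).integrable_map_iff] at this
    exact this
  refine (h1.comp_snd _).congr (ae_of_all _ fun z => ?_)
  simp only [smul_eq_mul]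
  rw [Real.rpow_sub_one z.2.2.1.ne']
  ring

/-! ### The limit theorem -/

theorem additiveEmbedding_prime (θ : ℝ → ℝ) (hθ0 : θ 0 = 0) {p : ℕ} (hp : p.Prime) :
    additiveEmbedding θ p = θ (Real.log p) := by
  rw [additiveEmbedding, hp.factorization, Finsupp.sum_single_index (by simp [hθ0])]
  simp

/-- This controls the geometric-to-Poisson error. For `γ ≤ 1 / 2` one has `(log p) ^ γ ≤ p ^ (1 /
2)`, which leaves the convergent series of `p ^ (-3 / 2)` times `(log n) ^ (-γ)`. -/
theorem tendsto_sum_log_div_log_rpow_div_sq {γ : ℝ} (hγ0 : 0 < γ) (hγ : γ ≤ 1 / 2) :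
    Tendsto (fun n : ℕ => ∑ p ∈ Nat.primesLE n, (Real.log p / Real.log n) ^ γ / (p : ℝ) ^ 2) atTop
      (𝓝 0) := by
  have hsum : Summable fun k : ℕ => (k : ℝ) ^ (-(3 / 2) : ℝ) :=
    Real.summable_nat_rpow.2 (by norm_num)
  have hlim : Tendsto (fun n : ℕ => Real.log n ^ (-γ) * ∑' k : ℕ, (k : ℝ) ^ (-(3 / 2) : ℝ)) atTop
      (𝓝 0) := by
    simpa using ((tendsto_rpow_neg_atTop hγ0).comp tendsto_log_natCast_atTop).mul_const
      (∑' k : ℕ, (k : ℝ) ^ (-(3 / 2) : ℝ))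
  refine squeeze_zero (fun n => Finset.sum_nonneg fun p hp => div_nonneg
    (Real.rpow_nonneg (log_div_log_mem_Ioc hp).1.le _) (by positivity)) (fun n => ?_) hlim
  have hln : 0 ≤ Real.log n := Real.log_natCast_nonneg n
  calc ∑ p ∈ Nat.primesLE n, (Real.log p / Real.log n) ^ γ / (p : ℝ) ^ 2
      ≤ ∑ p ∈ Nat.primesLE n, Real.log n ^ (-γ) * (p : ℝ) ^ (-(3 / 2) : ℝ) := by
        refine Finset.sum_le_sum fun p hp => ?_
        have hp1 : (1 : ℝ) ≤ p := by exact_mod_cast (Nat.one_lt_of_mem_primesLE hp).le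
        have hp0 : (0 : ℝ) < p := by linarith
        have h1 : Real.log p ^ γ ≤ (p : ℝ) ^ (1 / 2 : ℝ) :=
          (Real.rpow_le_rpow (Real.log_natCast_nonneg p) (Real.log_le_self hp0.le) hγ0.le).trans
            (Real.rpow_le_rpow_of_exponent_le hp1 hγ)
        have h2 : (p : ℝ) ^ (-(3 / 2) : ℝ) = (p : ℝ) ^ (1 / 2 : ℝ) / (p : ℝ) ^ 2 := by
          rw [← Real.rpow_natCast, ← Real.rpow_sub hp0]; norm_num
        rw [Real.div_rpow (Real.log_natCast_nonneg p) hln, Real.rpow_neg hln, h2, div_div,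
          ← div_eq_inv_mul, div_div, mul_comm (_ ^ γ)]
        gcongr
    _ ≤ _ := by
        rw [← Finset.mul_sum]
        exact mul_le_mul_of_nonneg_left (hsum.sum_le_tsum _ fun k _ => by positivity)
          (Real.rpow_nonneg hln _)

/-- A geometric sum over the primes whose weights are, on the logarithmic scale, asymptotically
given by `f`, has as limiting characteristic function that of a compound Poisson variable. -/
theorem tendsto_prod_geometric_factor {γ K : ℝ} (hγ0 : 0 < γ) (hγ : γ ≤ 1 / 2) {f : ℝ → ℝ}
    (hf : ContinuousOn f (Set.Ioc 0 1)) (hfb : ∀ x ∈ Set.Ioc (0 : ℝ) 1, |f x| ≤ K * x ^ γ)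
    {c : ℕ → ℕ → ℝ}
    (hc : ∀ δ : ℝ, 0 < δ → ∀ᶠ n in atTop, ∀ p ∈ Nat.primesLE n,
      |c n p - f (Real.log p / Real.log n)| ≤ δ * (Real.log p / Real.log n) ^ γ) :
    Tendsto (fun n : ℕ => ∏ p ∈ Nat.primesLE n,
        ((p : ℂ) - 1) / (p - Complex.exp (c n p * Complex.I))) atTop
      (𝓝 (Complex.exp (∫ x in Set.Ioc (0 : ℝ) 1, (1 / x) • (Complex.exp (f x * Complex.I) - 1)))) :=
    by
  have hmain := tendsto_sum_primes_integral (C := K) hγ0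
    (g := fun x => Complex.exp (f x * Complex.I) - 1)
    (((Complex.continuous_ofReal.comp_continuousOn hf).mul continuousOn_const).cexp.sub
      continuousOn_const)
    fun x hx => (norm_cexp_mul_I_sub_one_le _).trans (hfb x hx)
  have hdiff : Tendsto (fun n : ℕ => ∑ p ∈ Nat.primesLE n,
        (1 / p : ℝ) • (Complex.exp (c n p * Complex.I) - 1)
      - ∑ p ∈ Nat.primesLE n,
        (1 / p : ℝ) • (Complex.exp (f (Real.log p / Real.log n) * Complex.I) - 1)) atTop (𝓝 0) := by
    rw [Metric.tendsto_nhds]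
    intro e he
    have hB := (tendsto_sum_log_div_log_rpow hγ0).eventually (gt_mem_nhds (lt_add_one (1 / γ)))
    have hK0 : 0 < 1 / γ + 1 := by positivity
    filter_upwards [hB, hc (e / (1 / γ + 1)) (by positivity)] with n hn hcn
    rw [dist_zero_right, ← Finset.sum_sub_distrib]
    refine (norm_sum_le _ _).trans_lt ?_
    calc _ ≤ ∑ p ∈ Nat.primesLE n,
          e / (1 / γ + 1) * ((Real.log p / Real.log n) ^ γ / p) := by
          refine Finset.sum_le_sum fun p hp => ?_
          rw [← smul_sub, sub_sub_sub_cancel_right, norm_smul, Real.norm_of_nonneg (by positivity)]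
          calc 1 / (p : ℝ) * _ ≤ 1 / (p : ℝ)
                * (e / (1 / γ + 1) * (Real.log p / Real.log n) ^ γ) :=
                mul_le_mul_of_nonneg_left ((norm_cexp_mul_I_sub_le _ _).trans (hcn p hp))
                  (by positivity)
            _ = _ := by ring
      _ < e / (1 / γ + 1) * (1 / γ + 1) := by
          rw [← Finset.mul_sum]
          exact mul_lt_mul_of_pos_left hn (by positivity)
      _ = e := by field_simp
  have hexp := (Complex.continuous_exp.tendsto _).comp (hdiff.add hmain)
  rw [zero_add] at hexp
  have herr : Tendsto (fun n : ℕ => ∏ p ∈ Nat.primesLE n,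
        ((p : ℂ) - 1) / (p - Complex.exp (c n p * Complex.I))
      - Complex.exp (∑ p ∈ Nat.primesLE n, (1 / p : ℝ) • (Complex.exp (c n p * Complex.I) - 1)))
      atTop (𝓝 0) := by
    -- Taking `δ = 1` in `hc` gives `|c n p| ≤ (1 + K) x ^ γ` at `x = log p / log n`.
    have hlim := (tendsto_sum_log_div_log_rpow_div_sq hγ0 hγ).const_mul (4 * (1 + K))
    rw [mul_zero] at hlim
    refine squeeze_zero_norm' ?_ hlim
    filter_upwards [hc 1 one_pos] with n hcn
    refine (norm_prod_geometric_factor_sub_exp_le n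
      fun p => Complex.norm_exp_ofReal_mul_I _).trans ?_
    rw [Finset.mul_sum]
    refine Finset.sum_le_sum fun p hp => ?_
    have h1 := hcn p hp
    have h2 := hfb _ (log_div_log_mem_Ioc hp)
    have h3 := norm_cexp_mul_I_sub_one_le (c n p)
    have h4 : |c n p| ≤ |c n p - f (Real.log p / Real.log n)| + |f (Real.log p / Real.log n)| := by
      simpa using abs_add_le (c n p - f (Real.log p / Real.log n)) (f (Real.log p / Real.log n))
    rw [← mul_div_assoc]
    refine div_le_div_of_nonneg_right ?_ (by positivity)
    linarith
  have := herr.add hexp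
  rw [zero_add] at this
  refine this.congr fun n => ?_
  simp

theorem proposition2
    {Ω Ω' : Type*} [MeasurableSpace Ω] [MeasurableSpace Ω']
    (P : Measure Ω) [IsProbabilityMeasure P] (P' : Measure Ω') [IsProbabilityMeasure P']
    (ε : ℕ → Ω → ℕ) (hε : IsGeometricPrimeFamily P ε)
    (η : Ω' → Measure DickmanSpace) (hη : IsPoissonRandomMeasure P' η dickmanIntensity)
    (θ : ℝ → ℝ) (hθ0 : θ 0 = 0) (hθ : ContDiffOn ℝ 1 θ (Set.Ioi 0))
    (hV : ClassV θ) (hdeg : 0 < degree θ) (u₁ u₂ : ℝ) :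
    (∀ᵐ ω ∂P', Integrable (fun z : DickmanSpace => (z.2 : ℝ) ^ degree θ) (η ω)) ∧
    (∀ᵐ ω ∂P', Integrable (fun z : DickmanSpace => (z.2 : ℝ)) (η ω)) ∧
    TendstoInDistribution (geometricSum θ u₁ u₂ ε) atTop
      (fun ω => u₁ * (∫ z : DickmanSpace, (z.2 : ℝ) ^ degree θ ∂(η ω))
        + u₂ * (∫ z : DickmanSpace, (z.2 : ℝ) ∂(η ω)))
      (fun _ => P) P' := by
  set α := degree θ with hα
  have hmα : Measurable fun z : DickmanSpace => (z.2 : ℝ) ^ α := by fun_prop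
  have hm1 : Measurable fun z : DickmanSpace => (z.2 : ℝ) := by fun_prop
  have hiα := integrable_rpow_dickmanIntensity hdeg
  have hi1 : Integrable (fun z : DickmanSpace => (z.2 : ℝ)) dickmanIntensity := by
    simpa using integrable_rpow_dickmanIntensity one_pos
  have haeα := hη.ae_integrable hmα hiα
  have hae1 := hη.ae_integrable hm1 hi1
  refine ⟨haeα, hae1, ?_⟩
  have hlimm : AEMeasurable (fun ω => u₁ * (∫ z : DickmanSpace, (z.2 : ℝ) ^ α ∂(η ω))
      + u₂ * (∫ z : DickmanSpace, (z.2 : ℝ) ∂(η ω))) P' :=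
    ((hη.aemeasurable_integral hmα hiα).const_mul _).add
      ((hη.aemeasurable_integral hm1 hi1).const_mul _)
  have hZm : ∀ n, AEMeasurable (geometricSum θ u₁ u₂ ε n) P := fun n =>
    Finset.aemeasurable_fun_sum _ fun p hp => by
      have := hε.measurable p (Nat.prime_of_mem_primesLE hp)
      fun_prop
  refine ⟨hZm, hlimm, ProbabilityMeasure.tendsto_iff_tendsto_charFun.2 fun t => ?_⟩
  simp only [ProbabilityMeasure.coe_mk]
  set f : ℝ → ℝ := fun x => t * (u₁ * x ^ α + u₂ * x) with hf
  have hlim : charFun (P'.map fun ω => u₁ * (∫ z : DickmanSpace, (z.2 : ℝ) ^ α ∂(η ω))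
        + u₂ * (∫ z : DickmanSpace, (z.2 : ℝ) ∂(η ω))) t
      = Complex.exp
        (∫ x in Set.Ioc (0 : ℝ) 1, (1 / x) • (Complex.exp (f x * Complex.I) - 1)) := by
    have hfi : Integrable (fun z : DickmanSpace => f z.2) dickmanIntensity :=
      ((hiα.const_mul u₁).add (hi1.const_mul u₂)).const_mul t
    rw [← integral_dickmanIntensity fun x => Complex.exp (f x * Complex.I) - 1,
      ← hη.integral_cexp_integral (f := fun z => f z.2) (by fun_prop) hfi, charFun_apply_real,
      integral_map hlimm (by fun_prop)]
    refine integral_congr_ae ?_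
    filter_upwards [haeα, hae1] with ω h1 h2
    simp only [hf]
    rw [integral_const_mul, integral_add (h1.const_mul _) (h2.const_mul _), integral_const_mul,
      integral_const_mul]
    push_cast
    rfl
  rw [hlim]
  -- This choice dominates both `x ^ α` and `x` by `x ^ γ` on `(0, 1]`, leaves room below `α` for
  -- Potter's bounds, and respects `γ ≤ 1 / 2`.
  set γ := min α 1 / 2 with hγ
  have hγ0 : 0 < γ := by positivity
  have hγα : γ < α := by have := min_le_left α 1; rw [hγ]; linarith
  have hγ1 : γ ≤ 1 / 2 := by have := min_le_right α 1; rw [hγ]; linarith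
  set c : ℕ → ℕ → ℝ := fun n p => t * (u₁ * additiveEmbedding θ p / θ (Real.log n)
    + u₂ * (Real.log p / Real.log n)) with hc
  have hchar : ∀ n, charFun (P.map (geometricSum θ u₁ u₂ ε n)) t
      = ∏ p ∈ Nat.primesLE n, ((p : ℂ) - 1) / (p - Complex.exp (c n p * Complex.I)) :=
    fun n => hε.charFun_map_sum n _ t
  simp only [hchar]
  refine tendsto_prod_geometric_factor (K := |t| * (|u₁| + |u₂|)) hγ0 hγ1 ?_ ?_ ?_
  · exact (((Real.continuous_rpow_const hdeg.le).const_mul u₁).add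
      (continuous_const_mul u₂) |>.const_mul t).continuousOn
  · intro x hx
    have h1 : x ^ α ≤ x ^ γ := Real.rpow_le_rpow_of_exponent_ge hx.1 hx.2 hγα.le
    have h2 : x ≤ x ^ γ := by
      simpa using Real.rpow_le_rpow_of_exponent_ge hx.1 hx.2 (by linarith : γ ≤ 1)
    simp only [hf]
    rw [abs_mul, mul_assoc]
    refine mul_le_mul_of_nonneg_left ((abs_add_le _ _).trans ?_) (abs_nonneg t)
    rw [abs_mul, abs_mul, abs_of_pos hx.1, abs_of_pos (Real.rpow_pos_of_pos hx.1 α), add_mul]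
    gcongr
  · intro δ hδ
    -- The smallest argument is `log 2`. The `u₂` terms cancel exactly, so only `t * u₁` enters; the
    -- `+ 1` covers `t * u₁ = 0`.
    have hreg := eventually_forall_abs_div_sub_rpow_le (a := Real.log 2)
      (ε := δ / (|t * u₁| + 1)) hγ0 hγα (by positivity) (Real.log_pos one_lt_two)
      hθ.continuousOn hV.isDegree_degree.2
    filter_upwards [tendsto_log_natCast_atTop.eventually hreg] with n hn p hp
    have hp2 : (2 : ℝ) ≤ p := by exact_mod_cast Nat.two_le_of_mem_primesLE hp
    have hpn : (p : ℝ) ≤ n := by exact_mod_cast Nat.le_of_mem_primesLE hp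
    have h1 := hn (Real.log p) (Real.log_le_log two_pos hp2) (Real.log_le_log (by linarith) hpn)
    have hx := (log_div_log_mem_Ioc hp).1
    have e : c n p - f (Real.log p / Real.log n) = t * u₁ * (θ (Real.log p) / θ (Real.log n)
        - (Real.log p / Real.log n) ^ α) := by
      simp only [hc, hf, additiveEmbedding_prime θ hθ0 (Nat.prime_of_mem_primesLE hp)]
      ring
    rw [e, abs_mul]
    refine (mul_le_mul_of_nonneg_left h1 (abs_nonneg _)).trans ?_
    rw [← mul_assoc]
    refine mul_le_mul_of_nonneg_right ?_ (Real.rpow_nonneg hx.le _)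
    rw [mul_div_assoc', div_le_iff₀ (by positivity)]
    nlinarith [abs_nonneg (t * u₁)]
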